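/- Let $\mathbb{C}^{\pm}$ be the open upper and lower half-planes and $\lambda_\pm(\xi)=\xi\pm i$. For $1<q<\infty$ let $H_q^{\pm}$ be the Hardy space of $\mathbb{C}^{\pm}$, identified with a closed subspace of $L_q=L_q(\mathbb{R})$ through nontangential boundary values, and let $P^{\pm}$ denote the projections of $L_q$ onto $H_q^{\pm}$ parallel to $H_q^{\mp}$. Put $\mathcal{L}_q=\lambda_+L_q$ and $\mathcal{H}_q^{\pm}=\lambda_\pm H_q^{\pm}$, and let $\Pi^{\pm}$ be the complementary projections of $\mathcal{L}_2$ onto $\mathcal{H}_2^+$ and onto $\lambda_+H_2^-\subset\mathcal{H}_2^-$ given by $\Pi^{\pm}\varphi=\lambda_+P^{\pm}(\lambda_+^{-1}\varphi)$. Let $1<p<\infty$, $\frac1p+\frac1{p'}=1$. A canonical $p$-factorization of a function $g$ on $\mathbb{R}$ is a representation $g=g_-g_+$ (a.e. on $\mathbb{R}$) where $g_\pm\neq0$ a.e. and $$g_+\in\mathcal{H}_{p'}^+,\quad g_+^{-1}\in\mathcal{H}_p^+,\quad g_-\in\mathcal{H}_p^-,\quad g_-^{-1}\in\mathcal{H}_{p'}^-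 .$$ If $g$ admits such a factorization, a branch of $\log g$ means a function $\varphi=\log h_-+\log h_+$ (a.e. on $\mathbb{R}$), where $g=h_-h_+$ is some canonical $p$-factorization of $g$ and $\log h_\pm$ are the nontangential boundary functions of analytic logarithms, in $\mathbb{C}^{\pm}$, of the analytic extensions of $h_\pm$. Suppose that $g$ admits a canonical $p$-factorization $g=g_-g_+$. Then a branch of $\log g$ exists, and every branch $\log g$ satisfies $\exp(\log g)=g$ a.e. and $\log g\in\mathcal{L}_2$, and there is a constant $C\in\mathbb{C}\setminus\{0\}$ such that, a.e. on $\mathbb{R}$, $$g_+=C\exp(\Pi^+\log g),\qquad g_-=C^{-1}\exp(\Pi^-\log g).$$ -/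

import Mathlib

open MeasureTheory Filter Topology

noncomputable section

/-- The two half-planes bounded by the real line. -/
inductive Side
  | upper
  | lower

/-- The sign `+1` of the upper half-plane `ℂ⁺`, and `-1` of the lower half-plane `ℂ⁻`. -/
def Side.sign : Side → ℝ
  | Side.upper => 1
  | Side.lower => -1

/-- The opposite half-plane. -/
def Side.opp : Side → Side
  | Side.upper => Side.lower
  | Side.lower => Side.upper

/-- The open half-plane `ℂ^σ`. -/
def Side.halfPlane (σ : Side) : Set ℂ := {z | 0 < σ.sign * z.im}

/-- `λ_σ(z) = z + i` for the upper sign and `λ_σ(z) = z - i` for the lower sign. -/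
def Side.lam (σ : Side) (z : ℂ) : ℂ := z + (σ.sign : ℂ) * Complex.I

/-- The cone of aperture `a` in `ℂ^σ` with vertex at the real point `x`. -/
def Side.cone (σ : Side) (a x : ℝ) : Set ℂ := {z | |z.re - x| < a * (σ.sign * z.im)}

/-- `F` has the nontangential limit `w` at the real point `x`, from within `ℂ^σ`. -/
def NontangentialLimit (σ : Side) (F : ℂ → ℂ) (x : ℝ) (w : ℂ) : Prop :=
  ∀ a : ℝ, 0 < a → Tendsto F (𝓝[σ.cone a x] (x : ℂ)) (𝓝 w)

/-- `F` is a function of the Hardy space `H^p(ℂ^σ)` (analytic, with bounded `L^p` means over the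
horizontal lines of `ℂ^σ`) whose nontangential boundary function is `f`. -/
structure IsHardyExtension (σ : Side) (p : ENNReal) (F : ℂ → ℂ) (f : ℝ → ℂ) : Prop where
  analytic : DifferentiableOn ℂ F σ.halfPlane
  bounded_means : ∃ M : NNReal, ∀ y : ℝ, 0 < y →
    eLpNorm (fun x : ℝ => F ((x : ℂ) + ((σ.sign * y : ℝ) : ℂ) * Complex.I)) p volume ≤ M
  boundary : ∀ᵐ x : ℝ, NontangentialLimit σ F x (f x)

/-- `f ∈ H_p^σ`: the Hardy space, identified with a subspace of `L_p` through the nontangential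
boundary functions. -/
def MemHardy (σ : Side) (p : ENNReal) (f : ℝ → ℂ) : Prop :=
  MemLp f p volume ∧ ∃ F : ℂ → ℂ, IsHardyExtension σ p F f

/-- `f ∈ 𝓗_p^σ = λ_σ H_p^σ`. -/
def MemCalHardy (σ : Side) (p : ENNReal) (f : ℝ → ℂ) : Prop :=
  MemHardy σ p (fun x => f x / σ.lam x)

/-- `f ∈ 𝓛_p = λ_+ L_p`. -/
def MemCalL (p : ENNReal) (f : ℝ → ℂ) : Prop :=
  MemLp (fun x => f x / Side.upper.lam x) p volume

/-- `g = g_- r^k g_+` is a `p`-factorization of `g`, where `r(ξ) = (ξ - i) / (ξ + i)`.  As elements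
of spaces of functions up to null sets, the factors have inverses only if they do not vanish
almost everywhere. -/
structure IsPFactorization (p : ℝ) (g gm : ℝ → ℂ) (k : ℤ) (gp : ℝ → ℂ) : Prop where
  eq_mul : ∀ᵐ x : ℝ, g x = gm x * (Side.lower.lam x / Side.upper.lam x) ^ k * gp x
  minus_ne_zero : ∀ᵐ x : ℝ, gm x ≠ 0
  plus_ne_zero : ∀ᵐ x : ℝ, gp x ≠ 0
  plus_mem : MemCalHardy Side.upper (ENNReal.ofReal p.conjExponent) gp
  plus_inv_mem : MemCalHardy Side.upper (ENNReal.ofReal p) (fun x => (gp x)⁻¹)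
  minus_mem : MemCalHardy Side.lower (ENNReal.ofReal p) gm
  minus_inv_mem : MemCalHardy Side.lower (ENNReal.ofReal p.conjExponent) (fun x => (gm x)⁻¹)

/-- A `p`-factorization is canonical if its index is `0`. -/
def IsCanonicalPFactorization (p : ℝ) (g gm gp : ℝ → ℂ) : Prop :=
  IsPFactorization p g gm 0 gp

/-- `u` is a branch of `log f` on the real line, for `f ∈ 𝓗_q^σ`: it is the nontangential boundary
function of an analytic logarithm, in `ℂ^σ`, of the analytic extension of `f` to `ℂ^σ`. -/
def IsLogOfFactor (σ : Side) (q : ENNReal) (f u : ℝ → ℂ) : Prop :=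
  ∃ ℓ : ℂ → ℂ, DifferentiableOn ℂ ℓ σ.halfPlane ∧
    IsHardyExtension σ q (fun z => Complex.exp (ℓ z) / σ.lam z) (fun x => f x / σ.lam x) ∧
    ∀ᵐ x : ℝ, NontangentialLimit σ ℓ x (u x)

/-- `φ` is a branch of `log g`, for a function `g` that admits a canonical `p`-factorization:
`φ = log h_- + log h_+` for a canonical `p`-factorization `g = h_- h_+` and for analytic branches
of `log h_-` and `log h_+` in the respective half-planes. -/
def IsLogBranch (p : ℝ) (g φ : ℝ → ℂ) : Prop :=
  ∃ hm hp um up : ℝ → ℂ, IsCanonicalPFactorization p g hm hp ∧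
    IsLogOfFactor Side.lower (ENNReal.ofReal p) hm um ∧
    IsLogOfFactor Side.upper (ENNReal.ofReal p.conjExponent) hp up ∧
    ∀ᵐ x : ℝ, φ x = um x + up x

open Classical in
/-- The projection `P^σ` of `L_p` onto `H_p^σ` parallel to the other Hardy space: the component
`u ∈ H_p^σ` in the (almost everywhere unique) decomposition `f = u + v` with `v` in the opposite
Hardy space.  For `1 < p < ∞` and `f ∈ L_p` there is such a decomposition. -/
def rieszProj (σ : Side) (p : ENNReal) (f : ℝ → ℂ) : ℝ → ℂ :=
  if h : ∃ u : ℝ → ℂ, MemHardy σ p u ∧ MemHardy σ.opp p (fun x => f x - u x)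
  then h.choose else 0

/-- `Π^σ φ = λ_+ P^σ (λ_+⁻¹ φ)`, the projection of `𝓛_2` onto `𝓗_2^σ` (with `λ_+` for both
signs). -/
def calProj (σ : Side) (φ : ℝ → ℂ) : ℝ → ℂ :=
  fun x => Side.upper.lam x * rieszProj σ 2 (fun t : ℝ => φ t / Side.upper.lam t) x

end

/-! Uniqueness. If `g = g₋g₊ = h₋h₊` are two canonical factorizations, then `g₊/h₊ = g₋⁻¹h₋` on the
line. The left side is the boundary function of `(z+i)²FG` with `F`, `G` in Hardy spaces of the
upper half-plane with conjugate exponents; the right side has the same structure in the lower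
half-plane. Poisson's formula holds for such weighted products (`UpperHardy.mul_eq_integral`),
because `(t+i)²` is exactly compensated by the decay of the kernel and `FG` converges to its
boundary function in `L¹`. Hence the left extension and the conjugate of the reflected right
extension are Poisson integrals of the same function, so a function is both analytic and
antianalytic, thus constant (`exists_const_of_mul_eq_conj`). Any two canonical factorizations
therefore differ by a constant.

Logarithms. The same formula, applied to `h₊` and `h₊⁻¹`, shows that their extensions are
reciprocal. So `h₊` has no zeros above the line, it has an analytic logarithm `ℓ` there, and `ℓ` has
nontangential limits wherever `h₊` has nonzero ones. The key point is that `ℓ/(z+i)` lies in `H²`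
(`UpperHardy.log`). From `x² ≤ eˣ + e⁻ˣ` with `x = Re ℓ`, the square `(Re ℓ)²` is at most `|h₊| +
|h₊|⁻¹`, which is dominated by a Poisson integral finite at `i`. The identity `|F|² = 2(Re F)² - Re
F²` then controls the whole of `ℓ` by its real part, first for compositions with maps into discs
fixing `i`, and in the limit by Fatou's lemma.

Conclusion. The same holds below the line by the reflection `z ↦ z̄`, the weight now being `z-i`. To
divide by `z+i` there, one subtracts from `log h₋` its value `c` at `-i`, which removes the pole.
Thus `log g = (log h₊ + c) + (log h₋ - c)` is the decomposition that defines `Π⁺` and `Π⁻`, unique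
because the two spaces `H²` meet only in `0`. Exponentiating gives `h₊` and `h₋` up to the factors
`e^c` and `e^{-c}`, and uniqueness passes from `h₊`, `h₋` to `g₊`, `g₋`. -/

open Complex (I)

/-! ### The Poisson kernel, and Poisson's formula for bounded analytic functions. -/

/-- The Poisson kernel of the upper half-plane. -/
noncomputable def halfPlanePoisson (w : ℂ) (t : ℝ) : ℝ := w.im / Real.pi / Complex.normSq (t - w)

lemma halfPlanePoisson_eq_cauchyPDFReal {w : ℂ} (hw : 0 < w.im) :
    halfPlanePoisson w = ProbabilityTheory.cauchyPDFReal w.re w.im.toNNReal := by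
  ext t
  simp only [halfPlanePoisson, ProbabilityTheory.cauchyPDFReal, Complex.normSq_apply,
    Real.coe_toNNReal _ hw.le, Complex.sub_re, Complex.sub_im, Complex.ofReal_re, Complex.ofReal_im]
  rw [show (t - w.re) * (t - w.re) + (0 - w.im) * (0 - w.im) = (t - w.re) ^ 2 + w.im ^ 2 by ring]
  ring

lemma ofReal_sub_ne_zero {w : ℂ} (hw : w.im ≠ 0) (t : ℝ) : (t : ℂ) - w ≠ 0 := by
  intro h
  have := congrArg Complex.im h
  simp at this
  exact hw this

lemma halfPlanePoisson_pos {w : ℂ} (hw : 0 < w.im) (t : ℝ) : 0 < halfPlanePoisson w t := by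
  have := Complex.normSq_pos.2 (ofReal_sub_ne_zero hw.ne' t)
  have := Real.pi_pos
  unfold halfPlanePoisson
  positivity

lemma continuous_halfPlanePoisson {w : ℂ} (hw : 0 < w.im) : Continuous (halfPlanePoisson w) := by
  unfold halfPlanePoisson
  refine continuous_const.div (by fun_prop) fun t => ?_
  exact (Complex.normSq_pos.2 (ofReal_sub_ne_zero hw.ne' t)).ne'

lemma integral_halfPlanePoisson {w : ℂ} (hw : 0 < w.im) : ∫ t, halfPlanePoisson w t = 1 := by
  rw [halfPlanePoisson_eq_cauchyPDFReal hw]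
  exact ProbabilityTheory.integral_cauchyPDFReal_eq_one _ (by simpa using hw)

lemma integrable_halfPlanePoisson {w : ℂ} (hw : 0 < w.im) : Integrable (halfPlanePoisson w) :=
  Integrable.of_integral_ne_zero (by simp [integral_halfPlanePoisson hw])

lemma lintegral_halfPlanePoisson {w : ℂ} (hw : 0 < w.im) :
    ∫⁻ t, ENNReal.ofReal (halfPlanePoisson w t) = 1 := by
  rw [← ofReal_integral_eq_lintegral_ofReal (integrable_halfPlanePoisson hw)
    (Eventually.of_forall fun t => (halfPlanePoisson_pos hw t).le), integral_halfPlanePoisson hw]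
  simp

lemma halfPlanePoisson_I (t : ℝ) : halfPlanePoisson I t = 1 / Real.pi / (1 + t ^ 2) := by
  simp [halfPlanePoisson, Complex.normSq_apply]
  ring

/-- Write `t + i = (t - w) + (w + i)` and absorb the fixed second term with `|t - w| ≥ Im w`. -/
lemma norm_add_I_le_mul {w : ℂ} (hw : 0 < w.im) (t : ℝ) :
    ‖(t : ℂ) + I‖ ≤ (1 + ‖w + I‖ / w.im) * ‖(t : ℂ) - w‖ := by
  have h1 : w.im ≤ ‖(t : ℂ) - w‖ := by
    have := Complex.abs_im_le_norm ((t : ℂ) - w)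
    simp only [Complex.sub_im, Complex.ofReal_im, zero_sub, abs_neg] at this
    exact (le_abs_self _).trans this
  have h2 : ‖(t : ℂ) + I‖ ≤ ‖(t : ℂ) - w‖ + ‖w + I‖ := by
    refine le_trans (le_of_eq ?_) (norm_add_le _ _)
    congr 1
    ring
  have h3 : ‖w + I‖ ≤ ‖w + I‖ / w.im * ‖(t : ℂ) - w‖ := by
    rw [div_mul_eq_mul_div, le_div_iff₀ hw]
    gcongr
  linarith

/-- Each Poisson kernel is bounded by a multiple of `1 / |t + i|²`. -/
lemma halfPlanePoisson_le {w : ℂ} (hw : 0 < w.im) :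
    ∃ C : ℝ, 0 < C ∧ ∀ t : ℝ, halfPlanePoisson w t ≤ C / ‖(t : ℂ) + I‖ ^ 2 := by
  set K : ℝ := 1 + ‖w + I‖ / w.im
  have hK : 0 < K := by positivity
  refine ⟨w.im / Real.pi * K ^ 2, by have := Real.pi_pos; positivity, fun t => ?_⟩
  have h0 : 0 < ‖(t : ℂ) + I‖ := by
    have := ofReal_sub_ne_zero (w := -I) (by simp) t
    rw [sub_neg_eq_add] at this
    exact norm_pos_iff.2 this
  have h1 : 0 < ‖(t : ℂ) - w‖ := norm_pos_iff.2 (ofReal_sub_ne_zero hw.ne' t)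
  have h2 := norm_add_I_le_mul hw t
  have := Real.pi_pos
  rw [halfPlanePoisson, Complex.normSq_eq_norm_sq, mul_div_assoc]
  rw [div_eq_mul_inv _ (‖(t : ℂ) - w‖ ^ 2)]
  gcongr
  rw [inv_eq_one_div, div_le_div_iff₀ (by positivity) (by positivity), one_mul, ← mul_pow]
  gcongr

/-- Poisson's formula for bounded functions analytic on a neighbourhood of each point of the closed
upper half-plane. -/
theorem integral_halfPlanePoisson_mul_of_bounded {F : ℂ → ℂ} {B : ℝ}
    (hF : ∀ z : ℂ, 0 ≤ z.im → DifferentiableAt ℂ F z) (hB : ∀ z : ℂ, 0 ≤ z.im → ‖F z‖ ≤ B)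
    {w : ℂ} (hw : 0 < w.im) :
    ∫ t : ℝ, (halfPlanePoisson w t : ℂ) * F t = F w := by
  have hB0 : 0 ≤ B := (norm_nonneg _).trans (hB w hw.le)
  set S : Set ℂ := {z | 0 ≤ z.im}
  have hS : S ∈ 𝓝 w := by
    filter_upwards [Complex.continuous_im.continuousAt.eventually (lt_mem_nhds hw)] with z hz
    exact hz.le
  have hd : DifferentiableOn ℂ (dslope F w) S :=
    (Complex.differentiableOn_dslope hS).2 fun z hz => (hF z hz).differentiableWithinAt
  have hcj : ∀ z ∈ S, z - (starRingEnd ℂ) w ≠ 0 := by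
    intro z hz h
    have := congrArg Complex.im h
    simp at this
    have hz' : 0 ≤ z.im := hz
    linarith
  -- On the line, `H` is `(F t - F w) / |t - w|²`, that is, the Poisson kernel times `F t - F w` up
  -- to the factor `π / Im w`. It is analytic in the closed half-plane and of order `|z|⁻²` at
  -- infinity, so Cauchy's theorem on large rectangles gives integral `0`.
  set H : ℂ → ℂ := fun z => dslope F w z / (z - (starRingEnd ℂ) w)
  have hH : DifferentiableOn ℂ H S := hd.div (by fun_prop) hcj
  have hHt : ∀ t : ℝ, H t = (Real.pi / w.im : ℝ) * ((halfPlanePoisson w t : ℂ) * F t -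
      halfPlanePoisson w t * F w) := by
    intro t
    have h1 := ofReal_sub_ne_zero hw.ne' t
    have h2 : (t : ℂ) - (starRingEnd ℂ) w ≠ 0 := hcj t (by simp [S])
    have h3 : ((Complex.normSq ((t : ℂ) - w) : ℝ) : ℂ) = (t - w) * (t - (starRingEnd ℂ) w) := by
      rw [← Complex.mul_conj]; simp
    have h4 : (Real.pi : ℂ) ≠ 0 := by exact_mod_cast Real.pi_ne_zero
    have h5 : (w.im : ℂ) ≠ 0 := by exact_mod_cast hw.ne'
    have h6 : (t : ℂ) ≠ w := sub_ne_zero.1 h1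
    simp only [H, dslope_of_ne _ h6, slope_def_field, halfPlanePoisson]
    push_cast
    rw [h3]
    field_simp
  have hbound : ∀ R : ℝ, 2 * ‖w‖ + 1 ≤ R → ∀ z ∈ S, R ≤ ‖z‖ → ‖H z‖ ≤ 8 * B / R ^ 2 := by
    intro R hR z hz hzR
    have hw0 := norm_nonneg w
    have h1 : R / 2 ≤ ‖z - w‖ := by have := norm_sub_norm_le z w; linarith
    have h2 : R / 2 ≤ ‖z - (starRingEnd ℂ) w‖ := by
      have := norm_sub_norm_le z ((starRingEnd ℂ) w)
      rw [Complex.norm_conj] at this; linarith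
    have hne : z ≠ w := by rintro rfl; linarith
    simp only [H, dslope_of_ne _ hne, slope_def_field, norm_div]
    rw [div_div, div_le_div_iff₀ (by nlinarith) (by nlinarith)]
    have h3 : ‖F z - F w‖ ≤ 2 * B :=
      (norm_sub_le _ _).trans (by linarith [hB z hz, hB w hw.le])
    have h4 : R ^ 2 ≤ 4 * (‖z - w‖ * ‖z - (starRingEnd ℂ) w‖) := by
      have := mul_le_mul h1 h2 (by linarith) (norm_nonneg _)
      linarith
    calc ‖F z - F w‖ * R ^ 2 ≤ 2 * B * (4 * (‖z - w‖ * ‖z - (starRingEnd ℂ) w‖)) := by gcongr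
      _ = _ := by ring
  have hrect : ∀ R : ℝ, 2 * ‖w‖ + 1 ≤ R → ‖∫ x : ℝ in (-R)..R, H x‖ ≤ 32 * B / R := by
    intro R hR
    have hR0 : 0 < R := by have := norm_nonneg w; linarith
    have key := Complex.integral_boundary_rect_eq_zero_of_differentiableOn H (-R : ℝ) (R + R * I)
      (hH.mono (by
        intro z hz
        have := hz.2
        simp [hR0.le] at this
        exact this.1))
    simp only [Complex.ofReal_re, Complex.ofReal_im, Complex.add_re, Complex.add_im,
      Complex.mul_re, Complex.mul_im, Complex.I_re, Complex.I_im, mul_zero, mul_one, zero_mul,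
      sub_zero, add_zero, zero_add, Complex.ofReal_zero] at key
    have e1 : ‖∫ x : ℝ in (-R)..R, H (x + R * I)‖ ≤ 8 * B / R ^ 2 * |R - -R| := by
      refine intervalIntegral.norm_integral_le_of_norm_le_const fun x _ => ?_
      refine hbound R hR _ (by simp [S, hR0.le]) ?_
      refine le_trans ?_ (Complex.abs_im_le_norm _)
      simp [abs_of_pos hR0]
    have e2 : ‖∫ y : ℝ in (0:ℝ)..R, H (R + y * I)‖ ≤ 8 * B / R ^ 2 * |R - 0| := by
      refine intervalIntegral.norm_integral_le_of_norm_le_const fun y hy => ?_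
      rw [Set.uIoc_of_le hR0.le] at hy
      refine hbound R hR _ (by simp [S, hy.1.le]) ?_
      refine le_trans ?_ (Complex.abs_re_le_norm _)
      simp [abs_of_pos hR0]
    have e3 : ‖∫ y : ℝ in (0:ℝ)..R, H ((-R : ℝ) + y * I)‖ ≤ 8 * B / R ^ 2 * |R - 0| := by
      refine intervalIntegral.norm_integral_le_of_norm_le_const fun y hy => ?_
      rw [Set.uIoc_of_le hR0.le] at hy
      refine hbound R hR _ (by simp [S, hy.1.le]) ?_
      refine le_trans ?_ (Complex.abs_re_le_norm _)
      simp [abs_of_pos hR0]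
    have e4 : (∫ x : ℝ in (-R)..R, H x) = (∫ x : ℝ in (-R)..R, H (x + R * I))
        - I * (∫ y : ℝ in (0:ℝ)..R, H (R + y * I))
        + I * (∫ y : ℝ in (0:ℝ)..R, H ((-R : ℝ) + y * I)) := by
      simp only [smul_eq_mul] at key
      linear_combination key
    rw [e4]
    refine (norm_add_le _ _).trans ?_
    refine (add_le_add_left (norm_sub_le _ _) _).trans ?_
    rw [norm_mul, norm_mul, Complex.norm_I, one_mul, one_mul]
    rw [sub_neg_eq_add, abs_of_pos (by linarith)] at e1
    rw [sub_zero, abs_of_pos hR0] at e2 e3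
    refine (add_le_add (add_le_add e1 e2) e3).trans (le_of_eq ?_)
    field_simp
    ring
  have hint : Integrable (fun t : ℝ => (halfPlanePoisson w t : ℂ) * F t) := by
    refine (integrable_halfPlanePoisson hw).ofReal.mul_bdd (c := B) ?_ ?_
    · refine Continuous.aestronglyMeasurable ?_
      exact continuous_iff_continuousAt.2 fun t =>
        ContinuousAt.comp (f := fun t : ℝ => (t : ℂ)) (hF t (by simp)).continuousAt
          Complex.continuous_ofReal.continuousAt
    · exact Eventually.of_forall fun t => hB t (by simp)
  have hint2 : Integrable (fun t : ℝ => (halfPlanePoisson w t : ℂ) * F w) :=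
    (integrable_halfPlanePoisson hw).ofReal.mul_const _
  have hHint : Integrable (fun t : ℝ => H t) := by
    simp_rw [hHt]
    exact (hint.sub hint2).const_mul _
  have hlim : Tendsto (fun R : ℝ => ∫ x : ℝ in (-R)..R, H x) atTop (𝓝 (∫ x : ℝ, H x)) :=
    intervalIntegral_tendsto_integral hHint tendsto_neg_atTop_atBot tendsto_id
  have hlim0 : Tendsto (fun R : ℝ => ∫ x : ℝ in (-R)..R, H x) atTop (𝓝 0) := by
    refine squeeze_zero_norm' (a := fun R => 32 * B / R) ?_ (tendsto_const_nhds.div_atTop tendsto_id)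
    filter_upwards [eventually_ge_atTop (2 * ‖w‖ + 1)] with R hR using hrect R hR
  have h0 : ∫ x : ℝ, H x = 0 := tendsto_nhds_unique hlim hlim0
  simp_rw [hHt] at h0
  rw [integral_const_mul, integral_sub hint hint2, integral_mul_const, integral_complex_ofReal,
    integral_halfPlanePoisson hw] at h0
  have h5 : ((Real.pi / w.im : ℝ) : ℂ) ≠ 0 := by
    exact_mod_cast (div_pos Real.pi_pos hw).ne'
  have := (mul_eq_zero.1 h0).resolve_left h5
  rw [sub_eq_zero] at this
  simpa using this

/-! ### Harmonic measures. -/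

/-- The harmonic measure of the upper half-plane, with density the Poisson kernel. -/
noncomputable def poissonMeasure (w : ℂ) : Measure ℝ :=
  volume.withDensity fun t => ENNReal.ofReal (halfPlanePoisson w t)

lemma measurable_halfPlanePoisson : Measurable fun p : ℂ × ℝ => halfPlanePoisson p.1 p.2 := by
  unfold halfPlanePoisson
  have h1 : Measurable fun p : ℂ × ℝ => p.1.im := Complex.measurable_im.comp measurable_fst
  have h2 : Measurable fun p : ℂ × ℝ => Complex.normSq ((p.2 : ℂ) - p.1) := by
    refine Continuous.measurable ?_
    fun_prop
  fun_prop

lemma measurable_ofReal_halfPlanePoisson (w : ℂ) :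
    Measurable fun t => ENNReal.ofReal (halfPlanePoisson w t) :=
  (measurable_halfPlanePoisson.comp (measurable_const.prodMk measurable_id)).ennreal_ofReal

lemma lintegral_poissonMeasure (w : ℂ) (f : ℝ → ENNReal) :
    ∫⁻ t, f t ∂poissonMeasure w = ∫⁻ t, ENNReal.ofReal (halfPlanePoisson w t) * f t := by
  rw [poissonMeasure, lintegral_withDensity_eq_lintegral_mul_non_measurable _
    (measurable_ofReal_halfPlanePoisson w) (Eventually.of_forall fun t => ENNReal.ofReal_lt_top)]
  rfl

lemma isProbabilityMeasure_poissonMeasure {w : ℂ} (hw : 0 < w.im) :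
    IsProbabilityMeasure (poissonMeasure w) := by
  refine ⟨?_⟩
  rw [← lintegral_one, lintegral_poissonMeasure]
  simpa using lintegral_halfPlanePoisson hw

lemma integral_poissonMeasure {w : ℂ} (hw : 0 < w.im) (f : ℝ → ℂ) :
    ∫ t, f t ∂poissonMeasure w = ∫ t, (halfPlanePoisson w t : ℂ) * f t := by
  rw [poissonMeasure, integral_withDensity_eq_integral_toReal_smul
    (measurable_ofReal_halfPlanePoisson w) (Eventually.of_forall fun t => ENNReal.ofReal_lt_top)]
  refine integral_congr_ae (Eventually.of_forall fun t => ?_)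
  simp [ENNReal.toReal_ofReal (halfPlanePoisson_pos hw t).le]

lemma poissonMeasure_absolutelyContinuous (w : ℂ) : poissonMeasure w ≪ volume :=
  withDensity_absolutelyContinuous _ _

/-- The kernel is bounded, since `|t + i| ≥ 1`. This turns `L^q` bounds for Lebesgue measure into
bounds for the finite measure `poissonMeasure w`. -/
lemma exists_poissonMeasure_le {w : ℂ} (hw : 0 < w.im) :
    ∃ C : NNReal, ∀ f : ℝ → ENNReal, ∫⁻ t, f t ∂poissonMeasure w ≤ C * ∫⁻ t, f t := by
  obtain ⟨C, hC, h⟩ := halfPlanePoisson_le hw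
  refine ⟨C.toNNReal, fun f => ?_⟩
  rw [lintegral_poissonMeasure, ← lintegral_const_mul' _ _ ENNReal.coe_ne_top]
  refine lintegral_mono fun t => ?_
  gcongr
  refine ENNReal.ofReal_le_ofReal ((h t).trans (div_le_self hC.le ?_))
  have : (1 : ℝ) ≤ ‖(t : ℂ) + I‖ := by
    refine le_trans ?_ (Complex.abs_im_le_norm _)
    simp
  exact one_le_pow₀ this

/-! ### Boundedness of Hardy functions away from the real line. -/

section HardyBounds

/-- A function with bounded `L^q` means on horizontal lines is bounded on each smaller
half-plane. -/
lemma exists_bound_of_lintegral_le {q : ℝ} (hq : 1 ≤ q) {F : ℂ → ℂ}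
    (hF : DifferentiableOn ℂ F {z | 0 < z.im}) {M : ENNReal} (hM : M ≠ ⊤)
    (h : ∀ y : ℝ, 0 < y → ∫⁻ x : ℝ, ‖F (x + y * I)‖ₑ ^ q ≤ M) {y₀ : ℝ} (hy₀ : 0 < y₀) :
    ∃ B : ℝ, ∀ z : ℂ, y₀ ≤ z.im → ‖F z‖ ≤ B := by
  have hU : IsOpen {z : ℂ | 0 < z.im} := isOpen_lt continuous_const Complex.continuous_im
  have hcont : ∀ ζ : ℂ, 0 < ζ.im → Continuous fun t : ℝ => F (ζ + t) := by
    intro ζ hζ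
    refine continuous_iff_continuousAt.2 fun t => ?_
    have : ζ + t ∈ {z : ℂ | 0 < z.im} := by simpa using hζ
    exact ContinuousAt.comp (f := fun t : ℝ => ζ + (t : ℂ))
      (hF.differentiableAt (hU.mem_nhds this)).continuousAt (by fun_prop)
  -- By `|F| ≤ 1 + |F|^q`, integrals of `F` over short horizontal segments are bounded uniformly.
  -- They are increments `Φ (ζ + s) - Φ ζ` of a primitive, so Cauchy's estimate for the derivative
  -- in `ζ` bounds `F (z + s) - F z`.
  have hint : ∀ ζ : ℂ, 0 < ζ.im → ∀ s : ℝ, 0 ≤ s →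
      ‖∫ t in (0 : ℝ)..s, F (ζ + t)‖ ≤ s + M.toReal := by
    intro ζ hζ s hs
    have h1 : ‖∫ t in (0 : ℝ)..s, F (ζ + t)‖ₑ ≤ ENNReal.ofReal s + M := by
      rw [intervalIntegral.integral_of_le hs]
      refine (enorm_integral_le_lintegral_enorm _).trans ?_
      have h2 : ∀ t : ℝ, ‖F (ζ + t)‖ₑ ≤ 1 + ‖F (ζ + t)‖ₑ ^ q := by
        intro t
        rcases le_total ‖F (ζ + t)‖ₑ 1 with h3 | h3
        · exact h3.trans le_self_add
        · refine le_trans ?_ le_add_self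
          simpa using ENNReal.rpow_le_rpow_of_exponent_le h3 hq
      refine (lintegral_mono h2).trans ?_
      rw [lintegral_add_left measurable_const]
      refine add_le_add (by simp) ?_
      refine (setLIntegral_le_lintegral _ _).trans ?_
      refine le_trans (le_of_eq ?_) (h ζ.im hζ)
      rw [← lintegral_add_left_eq_self (fun x : ℝ => ‖F (x + ζ.im * I)‖ₑ ^ q) ζ.re]
      refine lintegral_congr fun t => ?_
      congr 3
      conv_lhs => rw [← Complex.re_add_im ζ]
      push_cast
      ring
    have h3 := ENNReal.toReal_mono (by simp [hM]) h1
    rwa [toReal_enorm, ENNReal.toReal_add (by simp) hM, ENNReal.toReal_ofReal hs] at h3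
  set ρ := y₀ / 4
  have hρ : 0 < ρ := by positivity
  refine ⟨(ρ + M.toReal) / ρ + (ρ + M.toReal) / ρ, fun z hz => ?_⟩
  have hball : Metric.ball z (4 * ρ) ⊆ {z : ℂ | 0 < z.im} := by
    intro ζ hζ
    have h1 : |(ζ - z).im| < 4 * ρ := (Complex.abs_im_le_norm _).trans_lt (mem_ball_iff_norm.1 hζ)
    have h2 := (abs_lt.1 h1).1
    simp only [Complex.sub_im, ρ] at h2
    simp only [Set.mem_ofPred_eq]
    linarith
  obtain ⟨Φ, hΦ⟩ := (hF.mono hball).isExactOn_ball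
  have hmem : ∀ ζ ∈ Metric.closedBall z ρ, ∀ s : ℝ, 0 ≤ s → s ≤ ρ →
      ζ + s ∈ Metric.ball z (4 * ρ) := by
    intro ζ hζ s hs hs'
    rw [mem_ball_iff_norm]
    rw [mem_closedBall_iff_norm] at hζ
    calc ‖ζ + s - z‖ = ‖(ζ - z) + s‖ := by ring_nf
      _ ≤ ‖ζ - z‖ + ‖(s : ℂ)‖ := norm_add_le _ _
      _ ≤ ρ + ρ := by rw [Complex.norm_of_nonneg hs]; gcongr
      _ < 4 * ρ := by linarith
  have hFTC : ∀ ζ ∈ Metric.closedBall z ρ, ∀ s : ℝ, 0 ≤ s → s ≤ ρ →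
      ∫ t in (0 : ℝ)..s, F (ζ + t) = Φ (ζ + s) - Φ ζ := by
    intro ζ hζ s hs hs'
    have hζ' : 0 < ζ.im := by
      have := hball (hmem ζ hζ 0 le_rfl hρ.le)
      simpa using this
    rw [intervalIntegral.integral_eq_sub_of_hasDerivAt (f := fun t : ℝ => Φ (ζ + t))]
    · simp
    · intro t ht
      rw [Set.uIcc_of_le hs] at ht
      have h1 := hΦ _ (hmem ζ hζ t ht.1 (ht.2.trans hs'))
      have h2 : HasDerivAt (fun t : ℂ => Φ (ζ + t)) (F (ζ + t)) (t : ℂ) := by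
        simpa using HasDerivAt.comp_const_add ζ (t : ℂ) h1
      exact h2.comp_ofReal
    · exact (hcont ζ hζ').intervalIntegrable _ _
  have him : ∀ ζ ∈ Metric.closedBall z ρ, 0 < ζ.im := fun ζ hζ => by
    have := hball (hmem ζ hζ 0 le_rfl hρ.le)
    simpa using this
  have hz0 : z ∈ Metric.closedBall z ρ := Metric.mem_closedBall_self hρ.le
  have hdiff : ∀ s : ℝ, 0 ≤ s → s ≤ ρ → ‖F (z + s) - F z‖ ≤ (ρ + M.toReal) / ρ := by
    intro s hs hs'
    have hd : ∀ ζ ∈ Metric.closedBall z ρ,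
        HasDerivAt (fun ζ => Φ (ζ + s) - Φ ζ) (F (ζ + s) - F ζ) ζ := by
      intro ζ hζ
      have h1 := hΦ _ (hmem ζ hζ s hs hs')
      have h2 := hΦ _ (hmem ζ hζ 0 le_rfl hρ.le)
      rw [Complex.ofReal_zero, add_zero] at h2
      exact (HasDerivAt.comp_add_const ζ (s : ℂ) h1).sub h2
    rw [← (hd z hz0).deriv]
    refine Complex.norm_deriv_le_of_forall_mem_sphere_norm_le hρ ?_ ?_
    · refine DifferentiableOn.diffContOnCl fun ζ hζ => ?_
      rw [closure_ball z hρ.ne'] at hζ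
      exact (hd ζ hζ).differentiableAt.differentiableWithinAt
    · intro ζ hζ
      have hζ' := Metric.sphere_subset_closedBall hζ
      rw [← hFTC ζ hζ' s hs hs']
      exact (hint ζ (him ζ hζ') s hs).trans (by gcongr)
  have hzim := him z hz0
  have hci : IntervalIntegrable (fun t : ℝ => F (z + t)) volume 0 ρ :=
    (hcont z hzim).intervalIntegrable _ _
  -- The value `F z` is the mean of `F` over a segment minus the mean of the differences, and both
  -- are already bounded.
  have hsplit : (ρ : ℂ) * F z = (∫ t in (0 : ℝ)..ρ, F (z + t)) -
      ∫ t in (0 : ℝ)..ρ, (F (z + t) - F z) := by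
    rw [intervalIntegral.integral_sub hci intervalIntegrable_const]
    simp
  have h1 := hint z hzim ρ hρ.le
  have h2 : ‖∫ t in (0 : ℝ)..ρ, (F (z + t) - F z)‖ ≤ (ρ + M.toReal) / ρ * |ρ - 0| := by
    refine intervalIntegral.norm_integral_le_of_norm_le_const fun t ht => ?_
    rw [Set.uIoc_of_le hρ.le] at ht
    exact hdiff t ht.1.le ht.2
  rw [sub_zero, abs_of_pos hρ] at h2
  have h3 : ρ * ‖F z‖ ≤ (ρ + M.toReal) + (ρ + M.toReal) / ρ * ρ := by
    have : ρ * ‖F z‖ = ‖(ρ : ℂ) * F z‖ := by rw [norm_mul, Complex.norm_of_nonneg hρ.le]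
    rw [this, hsplit]
    exact (norm_sub_le _ _).trans (add_le_add h1 h2)
  rw [← add_div, le_div_iff₀ hρ]
  rw [div_mul_cancel₀ _ hρ.ne'] at h3
  linarith

end HardyBounds

/-! ### Limit theorems for integrals, without maximal functions. -/

/-- Convergence of integrals over a finite measure, for a sequence that converges almost
everywhere and is bounded in `L^q`, `1 < q`. -/
lemma tendsto_integral_of_lintegral_rpow_le {α : Type*} [MeasurableSpace α] {μ : Measure α}
    [IsFiniteMeasure μ] {q : ℝ} (hq : 1 < q) {f : ℕ → α → ℂ} {g : α → ℂ}
    (hf : ∀ n, AEStronglyMeasurable (f n) μ) (hfg : ∀ᵐ x ∂μ, Tendsto (fun n => f n x) atTop (𝓝 (g x)))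
    {M : ENNReal} (hM : M ≠ ⊤) (h : ∀ n, ∫⁻ x, ‖f n x‖ₑ ^ q ∂μ ≤ M) :
    Tendsto (fun n => ∫ x, f n x ∂μ) atTop (𝓝 (∫ x, g x ∂μ)) := by
  have hUI : UniformIntegrable f 1 μ := by
    refine uniformIntegrable_of le_rfl ENNReal.one_ne_top hf fun ε hε => ?_
    -- Chosen so that `M ≤ ε C^(q-1)`: where `|f n| ≥ C` one has `|f n| C^(q-1) ≤ |f n|^q`, whose
    -- integral is at most `M`. The maximum with `1` keeps `C^(q-1)` positive.
    set C : NNReal := max 1 ((M.toNNReal / ε.toNNReal) ^ (q - 1)⁻¹)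
    refine ⟨C, fun n => ?_⟩
    have hC1 : 1 ≤ C := le_max_left _ _
    have hε' : 0 < ε.toNNReal := by simpa using hε
    have hCM : M.toNNReal ≤ ε.toNNReal * C ^ (q - 1) := by
      have h1 : (M.toNNReal / ε.toNNReal) ^ (q - 1)⁻¹ ≤ C := le_max_right _ _
      have h2 := NNReal.rpow_le_rpow h1 (z := q - 1) (by linarith)
      rw [← NNReal.rpow_mul, inv_mul_cancel₀ (by linarith), NNReal.rpow_one] at h2
      rw [div_le_iff₀ hε'] at h2
      rwa [mul_comm]
    rw [eLpNorm_one_eq_lintegral_enorm]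
    have h3 : ∀ x, ‖({x | C ≤ ‖f n x‖₊}.indicator (f n)) x‖ₑ * (C : ENNReal) ^ (q - 1) ≤
        ‖f n x‖ₑ ^ q := by
      intro x
      by_cases hx : x ∈ {x | C ≤ ‖f n x‖₊}
      · rw [Set.indicator_of_mem hx]
        have h4 : (C : ENNReal) ≤ ‖f n x‖ₑ := by
          rw [enorm_eq_nnnorm]; exact_mod_cast hx
        calc ‖f n x‖ₑ * (C : ENNReal) ^ (q - 1) ≤ ‖f n x‖ₑ ^ (1 : ℝ) * ‖f n x‖ₑ ^ (q - 1) := by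
              rw [ENNReal.rpow_one]
              gcongr
          _ = ‖f n x‖ₑ ^ q := by
              rw [← ENNReal.rpow_add_of_nonneg _ _ zero_le_one (by linarith)]
              ring_nf
      · simp [Set.indicator_of_notMem hx]
    have hCpos : (C : ENNReal) ^ (q - 1) ≠ 0 := by
      refine (ENNReal.rpow_pos ?_ ENNReal.coe_ne_top).ne'
      exact_mod_cast zero_lt_one.trans_le hC1
    have hCtop : (C : ENNReal) ^ (q - 1) ≠ ⊤ :=
      ENNReal.rpow_ne_top_of_nonneg (by linarith) ENNReal.coe_ne_top
    rw [← ENNReal.mul_le_mul_iff_left hCpos hCtop, ← lintegral_mul_const' _ _ hCtop]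
    refine (lintegral_mono h3).trans ((h n).trans ?_)
    rw [← ENNReal.coe_toNNReal hM]
    refine (ENNReal.coe_le_coe.2 hCM).trans (le_of_eq ?_)
    rw [ENNReal.coe_mul, ← ENNReal.coe_rpow_of_nonneg _ (by linarith)]
    rfl
  have hg1 : MemLp g 1 μ := hUI.memLp_of_ae_tendsto hfg
  have hlim := tendsto_Lp_finite_of_tendsto_ae le_rfl ENNReal.one_ne_top hf hg1 hUI.unifIntegrable hfg
  exact tendsto_integral_of_L1' g hg1.aestronglyMeasurable
    (Eventually.of_forall fun n => memLp_one_iff_integrable.1 (hUI.memLp n)) hlim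

/-- The upper bound of `‖a * b‖` in Young's inequality. -/
noncomputable def youngBound (q r : ℝ) (p : ℂ × ℂ) : ENNReal :=
  ‖p.1‖ₑ ^ q / ENNReal.ofReal q + ‖p.2‖ₑ ^ r / ENNReal.ofReal r

lemma continuous_youngBound {q r : ℝ} (hq : 0 < q) (hr : 0 < r) :
    Continuous (youngBound q r) := by
  unfold youngBound
  simp only [div_eq_mul_inv]
  refine Continuous.add ?_ ?_
  · refine (ENNReal.continuous_mul_const ?_).comp
      (ENNReal.continuous_rpow_const.comp (continuous_enorm.comp continuous_fst))
    simpa using hq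
  · refine (ENNReal.continuous_mul_const ?_).comp
      (ENNReal.continuous_rpow_const.comp (continuous_enorm.comp continuous_snd))
    simpa using hr

lemma lintegral_youngBound {α : Type*} [MeasurableSpace α] {μ : Measure α} {q r : ℝ} (hq : 0 < q)
    (hr : 0 < r) {a b : α → ℂ} (ha : AEStronglyMeasurable a μ) :
    ∫⁻ x, youngBound q r (a x, b x) ∂μ = (∫⁻ x, ‖a x‖ₑ ^ q ∂μ) / ENNReal.ofReal q +
      (∫⁻ x, ‖b x‖ₑ ^ r ∂μ) / ENNReal.ofReal r := by
  simp only [youngBound, div_eq_mul_inv]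
  rw [lintegral_add_left' ((ha.enorm.pow_const _).mul_const _),
    lintegral_mul_const' _ _ (by simpa using hq), lintegral_mul_const' _ _ (by simpa using hr)]

lemma enorm_mul_le_youngBound {q r : ℝ} (hqr : q.HolderConjugate r) (a b : ℂ) :
    ‖a * b‖ₑ ≤ youngBound q r (a, b) := by
  rw [enorm_mul]
  exact ENNReal.young_inequality _ _ hqr

/-- A dominated convergence theorem with convergent dominating functions whose integrals do not
exceed the integral of their limit. -/
lemma tendsto_lintegral_zero_of_le_add {α : Type*} [MeasurableSpace α] {μ : Measure α}
    {Y Δ : ℕ → α → ENNReal} {Z : α → ENNReal} (hY : ∀ n, AEMeasurable (Y n) μ)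
    (hΔ : ∀ n, AEMeasurable (Δ n) μ) (hZ : AEMeasurable Z μ)
    (hle : ∀ n x, Δ n x ≤ Y n x + Z x)
    (hYZ : ∀ᵐ x ∂μ, Tendsto (fun n => Y n x) atTop (𝓝 (Z x)))
    (hΔ0 : ∀ᵐ x ∂μ, Tendsto (fun n => Δ n x) atTop (𝓝 0))
    (hZi : ∫⁻ x, Z x ∂μ ≠ ⊤) (hYi : ∀ n, ∫⁻ x, Y n x ∂μ ≤ ∫⁻ x, Z x ∂μ) :
    Tendsto (fun n => ∫⁻ x, Δ n x ∂μ) atTop (𝓝 0) := by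
  -- Fatou's lemma for the nonnegative functions `Y n + Z - Δ n`, with limit `Z + Z`, leaves no room
  -- for the mass of `Δ n`.
  have hhm : ∀ n, AEMeasurable (fun x => Y n x + Z x - Δ n x) μ := fun n =>
    ((hY n).add hZ).sub (hΔ n)
  have hsum : ∀ n, ∫⁻ x, (Y n x + Z x - Δ n x) ∂μ + ∫⁻ x, Δ n x ∂μ ≤
      ∫⁻ x, Z x ∂μ + ∫⁻ x, Z x ∂μ := by
    intro n
    rw [← lintegral_add_left' (hhm n)]
    simp only [tsub_add_cancel_of_le (hle n _)]
    rw [lintegral_add_left' (hY n)]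
    exact add_le_add (hYi n) le_rfl
  have hlim : ∀ᵐ x ∂μ, liminf (fun n => Y n x + Z x - Δ n x) atTop = Z x + Z x := by
    filter_upwards [hYZ, hΔ0] with x hx1 hx2
    have h3 := ENNReal.Tendsto.sub (hx1.add_const (Z x)) hx2 (Or.inr ENNReal.zero_ne_top)
    rw [tsub_zero] at h3
    exact h3.liminf_eq
  have hfatou : ∫⁻ x, Z x ∂μ + ∫⁻ x, Z x ∂μ ≤
      liminf (fun n => ∫⁻ x, (Y n x + Z x - Δ n x) ∂μ) atTop := by
    refine le_trans (le_of_eq ?_) (lintegral_liminf_le' hhm)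
    rw [lintegral_congr_ae hlim, lintegral_add_left' hZ]
  generalize ∫⁻ x, Z x ∂μ = D at *
  rw [ENNReal.tendsto_nhds_zero]
  intro ε hε
  rcases eq_or_ne (D + D) 0 with hD0 | hD0
  · refine Eventually.of_forall fun n => ?_
    have := (le_add_self.trans (hsum n))
    rw [hD0] at this
    exact this.trans zero_le
  have hDD : D + D ≠ ⊤ := ENNReal.add_ne_top.2 ⟨hZi, hZi⟩
  have hlt := (ENNReal.sub_lt_self hDD hD0 hε.ne').trans_le hfatou
  filter_upwards [eventually_lt_of_lt_liminf hlt] with n hn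
  have h1 := tsub_le_iff_right.1 hn.le
  have h2 := ne_top_of_le_ne_top hDD (le_self_add.trans (hsum n))
  exact (ENNReal.add_le_add_iff_left h2).1 ((hsum n).trans h1)

lemma aemeasurable_youngBound {α : Type*} [MeasurableSpace α] {μ : Measure α} {q r : ℝ}
    {a b : α → ℂ} (ha : AEStronglyMeasurable a μ) (hb : AEStronglyMeasurable b μ) :
    AEMeasurable (fun x => youngBound q r (a x, b x)) μ :=
  ((ha.enorm.pow_const _).div_const _).add ((hb.enorm.pow_const _).div_const _)

/-- Convergence in `L^1` of products, for sequences that converge almost everywhere without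
increase of their norms in `L^q` and in `L^r`, with `q` and `r` conjugate exponents. -/
lemma tendsto_lintegral_mul_sub_mul {α : Type*} [MeasurableSpace α] {μ : Measure α}
    {q r : ℝ} (hqr : q.HolderConjugate r) {u v : ℕ → α → ℂ} {f g : α → ℂ}
    (hu : ∀ n, AEStronglyMeasurable (u n) μ) (hv : ∀ n, AEStronglyMeasurable (v n) μ)
    (hf : AEStronglyMeasurable f μ) (hg : AEStronglyMeasurable g μ)
    (huf : ∀ᵐ x ∂μ, Tendsto (fun n => u n x) atTop (𝓝 (f x)))
    (hvg : ∀ᵐ x ∂μ, Tendsto (fun n => v n x) atTop (𝓝 (g x)))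
    (hfi : ∫⁻ x, ‖f x‖ₑ ^ q ∂μ ≠ ⊤) (hgi : ∫⁻ x, ‖g x‖ₑ ^ r ∂μ ≠ ⊤)
    (hun : ∀ n, ∫⁻ x, ‖u n x‖ₑ ^ q ∂μ ≤ ∫⁻ x, ‖f x‖ₑ ^ q ∂μ)
    (hvn : ∀ n, ∫⁻ x, ‖v n x‖ₑ ^ r ∂μ ≤ ∫⁻ x, ‖g x‖ₑ ^ r ∂μ) :
    Tendsto (fun n => ∫⁻ x, ‖u n x * v n x - f x * g x‖ₑ ∂μ) atTop (𝓝 0) := by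
  have hq := hqr.pos
  have hr := hqr.symm.pos
  have hYc := continuous_youngBound hq hr
  -- No common majorant of the products is available; Young's inequality supplies one that varies
  -- with `n`, converges, and does not exceed its limit in integral.
  refine tendsto_lintegral_zero_of_le_add (Y := fun n x => youngBound q r (u n x, v n x))
    (Z := fun x => youngBound q r (f x, g x)) (fun n => aemeasurable_youngBound (hu n) (hv n))
    (fun n => (((hu n).mul (hv n)).sub (hf.mul hg)).enorm) (aemeasurable_youngBound hf hg) (fun n x => ?_) ?_ ?_ ?_ ?_
  · exact enorm_sub_le.trans
      (add_le_add (enorm_mul_le_youngBound hqr _ _) (enorm_mul_le_youngBound hqr _ _))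
  · filter_upwards [huf, hvg] with x hx1 hx2
    exact (hYc.tendsto (f x, g x)).comp (hx1.prodMk_nhds hx2)
  · filter_upwards [huf, hvg] with x hx1 hx2
    simpa using ((hx1.mul hx2).sub_const (f x * g x)).enorm
  · rw [lintegral_youngBound hq hr hf]
    exact ENNReal.add_ne_top.2 ⟨ENNReal.div_ne_top hfi (by simpa using hq),
      ENNReal.div_ne_top hgi (by simpa using hr)⟩
  · intro n
    rw [lintegral_youngBound hq hr hf, lintegral_youngBound hq hr (hu n)]
    exact add_le_add (ENNReal.div_le_div_right (hun n) _) (ENNReal.div_le_div_right (hvn n) _)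

/-! ### Hardy functions of the upper half-plane and their Poisson representation. -/

/-- `F` is analytic in the upper half-plane, has bounded `L^q` means on horizontal lines, and
converges vertically to `f` almost everywhere. -/
structure UpperHardy (q : ℝ) (F : ℂ → ℂ) (f : ℝ → ℂ) : Prop where
  differentiableOn : DifferentiableOn ℂ F {z | 0 < z.im}
  means : ∃ M : ENNReal, M ≠ ⊤ ∧ ∀ y : ℝ, 0 < y → ∫⁻ x : ℝ, ‖F (x + y * I)‖ₑ ^ q ≤ M
  boundary : ∀ᵐ x : ℝ, Tendsto (fun n : ℕ => F (x + (1 / ((n : ℝ) + 1) : ℝ) * I)) atTop (𝓝 (f x))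

lemma isOpen_upper : IsOpen {z : ℂ | 0 < z.im} := isOpen_lt continuous_const Complex.continuous_im

lemma DifferentiableOn.continuous_horizontal {F : ℂ → ℂ}
    (hF : DifferentiableOn ℂ F {z | 0 < z.im}) {y : ℝ} (hy : 0 < y) :
    Continuous fun x : ℝ => F (x + y * I) := by
  refine hF.continuousOn.comp_continuous (by fun_prop) fun x => ?_
  simpa using hy

lemma DifferentiableOn.differentiableAt_shift {F : ℂ → ℂ}
    (hF : DifferentiableOn ℂ F {z | 0 < z.im}) {y : ℝ} (hy : 0 < y) {z : ℂ} (hz : 0 ≤ z.im) :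
    DifferentiableAt ℂ (fun z => F (z + y * I)) z := by
  have hm : z + y * I ∈ {z : ℂ | 0 < z.im} := by simp; linarith
  exact ((hF.differentiableAt (isOpen_upper.mem_nhds hm)).hasDerivAt.comp_add_const _ _).differentiableAt

lemma tendsto_vertical (w : ℂ) :
    Tendsto (fun n : ℕ => w + (1 / ((n : ℝ) + 1) : ℝ) * I) atTop (𝓝 w) := by
  have h := (Complex.continuous_ofReal.tendsto 0).comp (tendsto_one_div_add_atTop_nhds_zero_nat (𝕜 := ℝ))
  simpa [Function.comp_def] using (h.mul_const I).const_add w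

namespace UpperHardy

variable {q : ℝ} {F : ℂ → ℂ} {f : ℝ → ℂ}

lemma aestronglyMeasurable (h : UpperHardy q F f) : AEStronglyMeasurable f volume :=
  aestronglyMeasurable_of_tendsto_ae atTop
    (fun _ => (h.differentiableOn.continuous_horizontal (by positivity)).aestronglyMeasurable) h.boundary

lemma lintegral_ne_top (h : UpperHardy q F f) : ∫⁻ x, ‖f x‖ₑ ^ q ≠ ⊤ := by
  obtain ⟨M, hM, hb⟩ := h.means
  refine ne_top_of_le_ne_top hM ?_
  have h1 : ∀ᵐ x : ℝ, ‖f x‖ₑ ^ q =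
      liminf (fun n : ℕ => ‖F (x + (1 / ((n : ℝ) + 1) : ℝ) * I)‖ₑ ^ q) atTop := by
    filter_upwards [h.boundary] with x hx
    exact (((ENNReal.continuous_rpow_const.tendsto _).comp hx.enorm).liminf_eq).symm
  rw [lintegral_congr_ae h1]
  refine (lintegral_liminf_le' fun n => ?_).trans ?_
  · exact ((h.differentiableOn.continuous_horizontal (by positivity)).aestronglyMeasurable.enorm).pow_const _
  · refine liminf_le_of_le ⟨0, by simp⟩ fun b hb' => ?_
    obtain ⟨n, hn⟩ := hb'.exists
    exact hn.trans (hb _ (by positivity))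

/-- Shifted upwards by `y`, the function is bounded and analytic across the line, so Poisson's
formula for bounded functions applies. The formula for `F` itself follows by letting `y` tend to
`0`. -/
lemma shift_eq_integral (hq : 1 < q) (h : UpperHardy q F f) {y : ℝ} (hy : 0 < y) {w : ℂ}
    (hw : 0 < w.im) : ∫ t : ℝ, F (t + y * I) ∂poissonMeasure w = F (w + y * I) := by
  obtain ⟨M, hM, hb⟩ := h.means
  obtain ⟨B, hB⟩ := exists_bound_of_lintegral_le hq.le h.differentiableOn hM hb hy
  rw [integral_poissonMeasure hw]
  refine integral_halfPlanePoisson_mul_of_bounded (F := fun z => F (z + y * I)) (B := B)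
    (fun z hz => ?_) (fun z hz => hB _ (by simpa using hz)) hw
  exact h.differentiableOn.differentiableAt_shift hy hz

/-- Poisson's formula for functions of a Hardy space. -/
theorem eq_integral (hq : 1 < q) (h : UpperHardy q F f) {w : ℂ} (hw : 0 < w.im) :
    F w = ∫ t, f t ∂poissonMeasure w := by
  have := isProbabilityMeasure_poissonMeasure hw
  have hac := poissonMeasure_absolutelyContinuous w
  obtain ⟨M, hM, hb⟩ := h.means
  obtain ⟨C, hC⟩ := exists_poissonMeasure_le hw
  have hlim := tendsto_integral_of_lintegral_rpow_le (μ := poissonMeasure w) hq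
    (f := fun (n : ℕ) (t : ℝ) => F (t + (1 / ((n : ℝ) + 1) : ℝ) * I)) (g := f) (M := C * M)
    (fun n => (h.differentiableOn.continuous_horizontal (by positivity)).aestronglyMeasurable)
    (hac.ae_le h.boundary) (ENNReal.mul_ne_top ENNReal.coe_ne_top hM)
    (fun n => (hC _).trans (by gcongr; exact hb _ (by positivity)))
  refine tendsto_nhds_unique ?_ hlim
  have h1 : ∀ n : ℕ, ∫ t : ℝ, F (t + (1 / ((n : ℝ) + 1) : ℝ) * I) ∂poissonMeasure w =
      F (w + (1 / ((n : ℝ) + 1) : ℝ) * I) := fun n => h.shift_eq_integral hq (by positivity) hw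
  simp_rw [h1]
  exact (h.differentiableOn.differentiableAt
    (isOpen_upper.mem_nhds hw)).continuousAt.tendsto.comp (tendsto_vertical w)

end UpperHardy

/-- Jensen's inequality for the harmonic measure. -/
lemma enorm_integral_poissonMeasure_rpow_le {q : ℝ} (hq : 1 ≤ q) {f : ℝ → ℂ}
    (hf : AEStronglyMeasurable f volume) {w : ℂ} (hw : 0 < w.im) :
    ‖∫ t, f t ∂poissonMeasure w‖ₑ ^ q ≤ ∫⁻ t, ‖f t‖ₑ ^ q ∂poissonMeasure w := by
  have := isProbabilityMeasure_poissonMeasure hw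
  have hq0 : 0 < q := by linarith
  have h1 := eLpNorm_le_eLpNorm_of_exponent_le (μ := poissonMeasure w) (f := f) (p := 1)
    (q := ENNReal.ofReal q) (by simpa using hq)
    (hf.mono_ac (poissonMeasure_absolutelyContinuous w))
  rw [eLpNorm_one_eq_lintegral_enorm, eLpNorm_eq_lintegral_rpow_enorm_toReal
    (by simpa using hq0) ENNReal.ofReal_ne_top, ENNReal.toReal_ofReal hq0.le] at h1
  have h2 := ENNReal.rpow_le_rpow ((enorm_integral_le_lintegral_enorm f).trans h1) hq0.le
  rwa [← ENNReal.rpow_mul, one_div, inv_mul_cancel₀ hq0.ne', ENNReal.rpow_one] at h2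

/-- The kernel at height `y` is symmetric in `x` and `t`, so by Tonelli the integral over `x` gives
each `t` total mass `1`. -/
lemma lintegral_lintegral_poissonMeasure {m : ℝ → ENNReal} (hm : AEMeasurable m) {y : ℝ}
    (hy : 0 < y) : ∫⁻ x : ℝ, ∫⁻ t, m t ∂poissonMeasure (x + y * I) = ∫⁻ t, m t := by
  simp_rw [lintegral_poissonMeasure]
  rw [lintegral_lintegral_swap]
  · refine lintegral_congr fun t => ?_
    rw [lintegral_mul_const _ ?_]
    · have h1 : ∀ x : ℝ, halfPlanePoisson (x + y * I) t = halfPlanePoisson (t + y * I) x := by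
        intro x
        simp [halfPlanePoisson, Complex.normSq_apply]
        ring
      simp_rw [h1]
      rw [lintegral_halfPlanePoisson (by simpa using hy), one_mul]
    · refine (measurable_halfPlanePoisson.comp (Measurable.prodMk ?_ measurable_const)).ennreal_ofReal
      fun_prop
  · refine AEMeasurable.mul (Measurable.aemeasurable ?_) hm.comp_snd
    refine (measurable_halfPlanePoisson.comp (Measurable.prodMk ?_ measurable_snd)).ennreal_ofReal
    fun_prop

namespace UpperHardy

variable {q r : ℝ} {F G : ℂ → ℂ} {f g : ℝ → ℂ}

/-- Jensen's inequality for the Poisson representation, integrated over the line. The sharp constant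
`1` matters: it is the hypothesis of no increase of norms in `tendsto_lintegral_mul_sub_mul`. -/
lemma lintegral_le (hq : 1 < q) (h : UpperHardy q F f) {y : ℝ} (hy : 0 < y) :
    ∫⁻ x : ℝ, ‖F (x + y * I)‖ₑ ^ q ≤ ∫⁻ x, ‖f x‖ₑ ^ q := by
  rw [← lintegral_lintegral_poissonMeasure (h.aestronglyMeasurable.enorm.pow_const q) hy]
  refine lintegral_mono fun x => ?_
  have hx : 0 < ((x : ℂ) + y * I).im := by simpa using hy
  rw [h.eq_integral hq hx]
  exact enorm_integral_poissonMeasure_rpow_le hq.le h.aestronglyMeasurable hx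

end UpperHardy

/-! ### Poisson's formula for weighted products of Hardy functions. -/

lemma one_le_norm_add_I {z : ℂ} (hz : 0 ≤ z.im) : 1 ≤ ‖z + I‖ := by
  refine le_trans ?_ (Complex.abs_im_le_norm _)
  simp only [Complex.add_im, Complex.I_im]
  rw [abs_of_nonneg (by linarith)]
  linarith

lemma mul_norm_add_I_le {ε : ℝ} (hε : 0 ≤ ε) (hε1 : ε ≤ 1) {z : ℂ} (hz : 0 ≤ z.im) :
    ε * ‖z + I‖ ≤ ‖ε * z + I‖ := by
  refine le_of_sq_le_sq ?_ (norm_nonneg _)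
  rw [mul_pow, ← Complex.normSq_eq_norm_sq, ← Complex.normSq_eq_norm_sq]
  simp only [Complex.normSq_apply, Complex.add_re, Complex.add_im, Complex.mul_re, Complex.mul_im,
    Complex.ofReal_re, Complex.ofReal_im, Complex.I_re, Complex.I_im]
  have h1 : ε ^ 2 ≤ ε := by nlinarith
  nlinarith [mul_nonneg (sub_nonneg.2 h1) hz]

lemma one_le_norm_mul_add_I {ε : ℝ} (hε : 0 ≤ ε) {z : ℂ} (hz : 0 ≤ z.im) :
    1 ≤ ‖ε * z + I‖ :=
  one_le_norm_add_I (by simpa using mul_nonneg hε hz)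

lemma norm_shift_add_I_le {y : ℝ} (hy : 0 ≤ y) (hy1 : y ≤ 1) {z : ℂ} (hz : 0 ≤ z.im) :
    ‖z + y * I + I‖ ≤ 2 * ‖z + I‖ := by
  have h1 := one_le_norm_add_I hz
  calc ‖z + y * I + I‖ = ‖(z + I) + y * I‖ := by ring_nf
    _ ≤ ‖z + I‖ + ‖(y : ℂ) * I‖ := norm_add_le _ _
    _ = ‖z + I‖ + y := by simp [abs_of_nonneg hy]
    _ ≤ _ := by linarith

/-- Convergence of integrals of products, for a bounded sequence that converges pointwise and a
sequence that converges in `L^1`. -/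
lemma tendsto_integral_mul_of_tendsto_lintegral {α : Type*} [MeasurableSpace α] {μ : Measure α}
    {k a : ℕ → α → ℂ} {k₀ a₀ : α → ℂ} {K : ℝ} (hk : ∀ n x, ‖k n x‖ ≤ K)
    (hkm : ∀ n, AEStronglyMeasurable (k n) μ) (hkk : ∀ x, Tendsto (fun n => k n x) atTop (𝓝 (k₀ x)))
    (ha : ∀ n, AEStronglyMeasurable (a n) μ) (ha₀ : Integrable a₀ μ)
    (h : Tendsto (fun n => ∫⁻ x, ‖a n x - a₀ x‖ₑ ∂μ) atTop (𝓝 0)) :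
    Tendsto (fun n => ∫ x, k n x * a n x ∂μ) atTop (𝓝 (∫ x, k₀ x * a₀ x ∂μ)) := by
  have h1 : Tendsto (fun n => ∫ x, k n x * a₀ x ∂μ) atTop (𝓝 (∫ x, k₀ x * a₀ x ∂μ)) := by
    refine tendsto_integral_of_dominated_convergence (fun x => K * ‖a₀ x‖)
      (fun n => (hkm n).mul ha₀.1) (ha₀.norm.const_mul K) (fun n => ?_) ?_
    · refine Eventually.of_forall fun x => ?_
      rw [norm_mul]
      exact mul_le_mul_of_nonneg_right (hk n x) (norm_nonneg _)
    · exact Eventually.of_forall fun x => (hkk x).mul_const _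
  have hev : ∀ᶠ n in atTop, Integrable (a n) μ := by
    filter_upwards [h.eventually (gt_mem_nhds zero_lt_one)] with n hn
    have : Integrable (fun x => a n x - a₀ x) μ := ⟨(ha n).sub ha₀.1, hn.trans ENNReal.one_lt_top⟩
    exact (this.add ha₀).congr (Eventually.of_forall fun x => by simp)
  have h2 : Tendsto (fun n => ∫ x, k n x * (a n x - a₀ x) ∂μ) atTop (𝓝 0) := by
    rw [tendsto_zero_iff_enorm_tendsto_zero]
    refine tendsto_of_tendsto_of_tendsto_of_le_of_le tendsto_const_nhds
      (h := fun n => ENNReal.ofReal K * ∫⁻ x, ‖a n x - a₀ x‖ₑ ∂μ) ?_ (fun _ => zero_le) fun n => ?_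
    · simpa using ENNReal.Tendsto.const_mul h (Or.inr ENNReal.ofReal_ne_top)
    · refine (enorm_integral_le_lintegral_enorm _).trans ?_
      beta_reduce
      rw [← lintegral_const_mul' _ _ ENNReal.ofReal_ne_top]
      refine lintegral_mono fun x => ?_
      rw [enorm_mul]
      gcongr
      rw [← ofReal_norm]
      exact ENNReal.ofReal_le_ofReal (hk n x)
  have h3 := h2.add h1
  rw [zero_add] at h3
  refine h3.congr' ?_
  filter_upwards [hev] with n hn
  have e1 : Integrable (fun x => k n x * a n x) μ :=
    hn.bdd_mul (hkm n) (Eventually.of_forall (hk n))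
  have e2 : Integrable (fun x => k n x * a₀ x) μ :=
    ha₀.bdd_mul (hkm n) (Eventually.of_forall (hk n))
  simp_rw [mul_sub]
  rw [integral_sub e1 e2, sub_add_cancel]

namespace UpperHardy

variable {q r : ℝ} {F G : ℂ → ℂ} {f g : ℝ → ℂ}

lemma integrable_mul (hqr : q.HolderConjugate r) (hF : UpperHardy q F f) (hG : UpperHardy r G g) :
    Integrable fun t => f t * g t := by
  refine ⟨hF.aestronglyMeasurable.mul hG.aestronglyMeasurable, ?_⟩
  refine (lintegral_mono fun t => enorm_mul_le_youngBound hqr (f t) (g t)).trans_lt ?_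
  rw [lintegral_youngBound hqr.pos hqr.symm.pos hF.aestronglyMeasurable]
  exact ENNReal.add_lt_top.2 ⟨ENNReal.div_lt_top hF.lintegral_ne_top (by simpa using hqr.pos),
    ENNReal.div_lt_top hG.lintegral_ne_top (by simpa using hqr.symm.pos)⟩

lemma norm_halfPlanePoisson_mul_sq_le {w : ℂ} (hw : 0 < w.im) :
    ∃ C : ℝ, ∀ t : ℝ, halfPlanePoisson w t * ‖(t : ℂ) + I‖ ^ 2 ≤ C := by
  obtain ⟨C, -, h⟩ := halfPlanePoisson_le hw
  refine ⟨C, fun t => ?_⟩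
  have : 0 < ‖(t : ℂ) + I‖ := zero_lt_one.trans_le (one_le_norm_add_I (by simp))
  exact (le_div_iff₀ (by positivity)).1 (h t)

/-- Poisson's formula for the product of functions from Hardy spaces with conjugate exponents,
multiplied by `(z + i)²`. -/
theorem mul_eq_integral (hqr : q.HolderConjugate r) (hF : UpperHardy q F f)
    (hG : UpperHardy r G g) {w : ℂ} (hw : 0 < w.im) :
    (w + I) ^ 2 * (F w * G w) =
      ∫ t : ℝ, (halfPlanePoisson w t * ((t : ℂ) + I) ^ 2) * (f t * g t) := by
  set y : ℕ → ℝ := fun n => 1 / ((n : ℝ) + 1)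
  have hy : ∀ n, 0 < y n := fun n => by positivity
  have hy1 : ∀ n, y n ≤ 1 := fun n => by
    simp only [y]
    rw [div_le_one (by positivity)]
    linarith [(Nat.cast_nonneg n : (0 : ℝ) ≤ n)]
  have hy0 : Tendsto y atTop (𝓝 0) := tendsto_one_div_add_atTop_nhds_zero_nat
  have hyc : Tendsto (fun n => (y n : ℂ)) atTop (𝓝 0) := by
    rw [← Complex.ofReal_zero]
    exact (Complex.continuous_ofReal.tendsto 0).comp hy0
  -- The shifted `F` and `G` are bounded but the weight is not. The extra factor tends to `1` and
  -- damps the weight: `c n` is bounded for each `n`, by `4 / (y n)²`, while `4 |z + i|²` bounds it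
  -- uniformly in `n`.
  set c : ℕ → ℂ → ℂ := fun n z => (z + y n * I + I) ^ 2 * (I / (y n * z + I)) ^ 2
  have hc : ∀ z, Tendsto (fun n => c n z) atTop (𝓝 ((z + I) ^ 2)) := by
    intro z
    have h1 : Tendsto (fun n => (y n : ℂ) * z + I) atTop (𝓝 I) := by
      simpa using (hyc.mul_const z).add_const I
    have h2 : Tendsto (fun n => I / ((y n : ℂ) * z + I)) atTop (𝓝 1) := by
      rw [← div_self Complex.I_ne_zero]
      exact tendsto_const_nhds.div h1 Complex.I_ne_zero
    have h3 : Tendsto (fun n => z + y n * I + I) atTop (𝓝 (z + I)) := by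
      simpa using ((hyc.mul_const I).const_add z).add_const I
    simpa using (h3.pow 2).mul (h2.pow 2)
  have hc1 : ∀ n, ∀ z : ℂ, 0 ≤ z.im → ‖c n z‖ ≤ 4 * ‖z + I‖ ^ 2 := by
    intro n z hz
    have h1 := norm_shift_add_I_le (hy n).le (hy1 n) hz
    have h2 : ‖I / ((y n : ℂ) * z + I)‖ ≤ 1 := by
      rw [norm_div, Complex.norm_I]
      exact div_le_one_of_le₀ (one_le_norm_mul_add_I (hy n).le hz) (norm_nonneg _)
    simp only [c, norm_mul, norm_pow]
    calc ‖z + y n * I + I‖ ^ 2 * ‖I / ((y n : ℂ) * z + I)‖ ^ 2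
        ≤ (2 * ‖z + I‖) ^ 2 * 1 ^ 2 := by gcongr
      _ = _ := by ring
  have hc2 : ∀ n, ∀ z : ℂ, 0 ≤ z.im → ‖c n z‖ ≤ 4 / (y n) ^ 2 := by
    intro n z hz
    have h1 := norm_shift_add_I_le (hy n).le (hy1 n) hz
    have h2 := mul_norm_add_I_le (hy n).le (hy1 n) hz
    have h3 := zero_lt_one.trans_le (one_le_norm_mul_add_I (hy n).le hz)
    simp only [c, norm_mul, norm_pow, norm_div, Complex.norm_I]
    rw [← mul_pow, show (4 : ℝ) = 2 ^ 2 by norm_num, ← div_pow]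
    gcongr
    rw [mul_one_div, div_le_div_iff₀ h3 (hy n)]
    nlinarith [hy n]
  have hne : ∀ n, ∀ z : ℂ, 0 ≤ z.im → (y n : ℂ) * z + I ≠ 0 := fun n z hz =>
    norm_pos_iff.1 (zero_lt_one.trans_le (one_le_norm_mul_add_I (hy n).le hz))
  have hcd : ∀ n, ∀ z : ℂ, 0 ≤ z.im → DifferentiableAt ℂ (c n) z := by
    intro n z hz
    have := hne n z hz
    simp only [c]
    fun_prop (disch := assumption)
  have hshift : ∀ n, ∫ t : ℝ, (halfPlanePoisson w t * c n t) *
      (F (t + y n * I) * G (t + y n * I)) = c n w * (F (w + y n * I) * G (w + y n * I)) := by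
    intro n
    obtain ⟨M₁, hM₁, hb₁⟩ := hF.means
    obtain ⟨M₂, hM₂, hb₂⟩ := hG.means
    obtain ⟨B₁, hB₁⟩ := exists_bound_of_lintegral_le hqr.lt.le hF.differentiableOn hM₁ hb₁ (hy n)
    obtain ⟨B₂, hB₂⟩ := exists_bound_of_lintegral_le hqr.symm.lt.le hG.differentiableOn hM₂ hb₂ (hy n)
    have := integral_halfPlanePoisson_mul_of_bounded
      (F := fun z => c n z * (F (z + y n * I) * G (z + y n * I)))
      (B := 4 / (y n) ^ 2 * (B₁ * B₂)) ?_ ?_ hw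
    · simp_rw [← mul_assoc] at this ⊢
      exact this
    · intro z hz
      exact (hcd n z hz).mul ((hF.differentiableOn.differentiableAt_shift (hy n) hz).mul
        (hG.differentiableOn.differentiableAt_shift (hy n) hz))
    · intro z hz
      have hm : y n ≤ (z + y n * I).im := by simpa using hz
      rw [norm_mul, norm_mul (F _)]
      have h0 : 0 ≤ B₁ := (norm_nonneg _).trans (hB₁ _ hm)
      exact mul_le_mul (hc2 n z hz) (mul_le_mul (hB₁ _ hm) (hB₂ _ hm) (norm_nonneg _) h0)
        (by positivity) (by positivity)
  obtain ⟨C, hC⟩ := norm_halfPlanePoisson_mul_sq_le hw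
  -- The kernel times `c n` is bounded uniformly and converges pointwise, while the products of the
  -- shifted functions converge in `L¹`.
  have hlim : Tendsto (fun n => ∫ t : ℝ, (halfPlanePoisson w t * c n t) *
      (F (t + y n * I) * G (t + y n * I))) atTop
      (𝓝 (∫ t : ℝ, (halfPlanePoisson w t * ((t : ℂ) + I) ^ 2) * (f t * g t))) := by
    refine tendsto_integral_mul_of_tendsto_lintegral (K := 4 * C) ?_ ?_ ?_ ?_
      (hF.integrable_mul hqr hG) ?_
    · intro n t
      rw [norm_mul, Complex.norm_of_nonneg (halfPlanePoisson_pos hw t).le]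
      have h1 := hc1 n t (by simp)
      have h2 := hC t
      have h3 := mul_le_mul_of_nonneg_left h1 (halfPlanePoisson_pos hw t).le
      linarith
    · intro n
      refine Continuous.aestronglyMeasurable ?_
      refine (Complex.continuous_ofReal.comp (continuous_halfPlanePoisson hw)).mul ?_
      exact continuous_iff_continuousAt.2 fun t =>
        ContinuousAt.comp (f := fun t : ℝ => (t : ℂ)) (hcd n t (by simp)).continuousAt
          Complex.continuous_ofReal.continuousAt
    · intro t
      exact (hc t).const_mul _
    · intro n
      exact ((hF.differentiableOn.continuous_horizontal (hy n)).mul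
        (hG.differentiableOn.continuous_horizontal (hy n))).aestronglyMeasurable
    · exact tendsto_lintegral_mul_sub_mul hqr
        (fun n => (hF.differentiableOn.continuous_horizontal (hy n)).aestronglyMeasurable)
        (fun n => (hG.differentiableOn.continuous_horizontal (hy n)).aestronglyMeasurable)
        hF.aestronglyMeasurable hG.aestronglyMeasurable hF.boundary hG.boundary
        hF.lintegral_ne_top hG.lintegral_ne_top
        (fun n => hF.lintegral_le hqr.lt (hy n)) (fun n => hG.lintegral_le hqr.symm.lt (hy n))
  simp_rw [hshift] at hlim
  refine tendsto_nhds_unique ?_ hlim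
  refine (hc w).mul (Tendsto.mul ?_ ?_)
  · exact (hF.differentiableOn.differentiableAt
      (isOpen_upper.mem_nhds hw)).continuousAt.tendsto.comp (tendsto_vertical w)
  · exact (hG.differentiableOn.differentiableAt
      (isOpen_upper.mem_nhds hw)).continuousAt.tendsto.comp (tendsto_vertical w)

end UpperHardy

/-! ### Half-planes, cones and nontangential limits. -/

lemma Side.upper_halfPlane : Side.upper.halfPlane = {z : ℂ | 0 < z.im} := by
  simp [Side.halfPlane, Side.sign]

lemma Side.sign_opp (σ : Side) : σ.opp.sign = -σ.sign := by
  cases σ <;> simp [Side.opp, Side.sign]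

lemma Side.sign_mul_sign (σ : Side) : σ.sign * σ.sign = 1 := by
  cases σ <;> simp [Side.sign]

lemma Side.isOpen_halfPlane (σ : Side) : IsOpen σ.halfPlane :=
  isOpen_lt continuous_const (continuous_const.mul Complex.continuous_im)

lemma Side.convex_halfPlane (σ : Side) : Convex ℝ σ.halfPlane := by
  intro z hz w hw a b ha hb hab
  simp only [Side.halfPlane, Set.mem_ofPred_eq] at hz hw ⊢
  simp only [Complex.add_im, Complex.real_smul, Complex.mul_im, Complex.ofReal_re,
    Complex.ofReal_im, zero_mul, add_zero]
  rcases ha.eq_or_lt with rfl | ha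
  · simp at hab; subst hab; simpa using hw
  · nlinarith [mul_pos ha hz, mul_nonneg hb hw.le]

lemma Side.convex_cone (σ : Side) {a : ℝ} (x : ℝ) : Convex ℝ (σ.cone a x) := by
  intro z hz w hw s t hs ht hst
  simp only [Side.cone, Set.mem_ofPred_eq] at hz hw ⊢
  simp only [Complex.add_im, Complex.add_re, Complex.real_smul, Complex.mul_im, Complex.mul_re,
    Complex.ofReal_re, Complex.ofReal_im, zero_mul, add_zero, sub_zero]
  have h1 : s * z.re + t * w.re - x = s * (z.re - x) + t * (w.re - x) := by
    linear_combination x * hst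
  rw [h1]
  refine (abs_add_le _ _).trans_lt ?_
  rw [abs_mul, abs_mul, abs_of_nonneg hs, abs_of_nonneg ht]
  rcases hs.eq_or_lt with rfl | hs
  · simp at hst; subst hst; simpa using hw
  · nlinarith [mul_lt_mul_of_pos_left hz hs, mul_le_mul_of_nonneg_left hw.le ht]

lemma Side.cone_subset_halfPlane (σ : Side) {a : ℝ} (ha : 0 < a) (x : ℝ) :
    σ.cone a x ⊆ σ.halfPlane := by
  intro z hz
  have := (abs_nonneg _).trans_lt (show |z.re - x| < a * (σ.sign * z.im) from hz)
  exact pos_of_mul_pos_right this ha.le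

lemma Side.cone_mono (σ : Side) {a b : ℝ} (ha : 0 < a) (hab : a ≤ b) (x : ℝ) :
    σ.cone a x ⊆ σ.cone b x := by
  intro z hz
  have h : 0 < σ.sign * z.im := σ.cone_subset_halfPlane ha x hz
  exact lt_of_lt_of_le (show |z.re - x| < a * (σ.sign * z.im) from hz) (by gcongr)

lemma Side.tendsto_vertical_cone (σ : Side) {a : ℝ} (ha : 0 < a) (x : ℝ) :
    Tendsto (fun n : ℕ => (x : ℂ) + ((σ.sign * (1 / ((n : ℝ) + 1)) : ℝ) : ℂ) * I) atTop
      (𝓝[σ.cone a x] (x : ℂ)) := by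
  refine tendsto_nhdsWithin_iff.2 ⟨?_, Eventually.of_forall fun n => ?_⟩
  · have h1 : Tendsto (fun n : ℕ => σ.sign * (1 / ((n : ℝ) + 1))) atTop (𝓝 0) := by
      simpa using (tendsto_one_div_add_atTop_nhds_zero_nat (𝕜 := ℝ)).const_mul σ.sign
    have h2 := (Complex.continuous_ofReal.tendsto 0).comp h1
    simpa [Function.comp_def] using (h2.mul_const I).const_add (x : ℂ)
  · simp only [Side.cone, Set.mem_ofPred_eq, Complex.add_re, Complex.ofReal_re, Complex.re_ofReal_mul,
      Complex.I_re, mul_zero, add_zero, sub_self, abs_zero, Complex.add_im, Complex.ofReal_im,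
      Complex.im_ofReal_mul, Complex.I_im, mul_one, zero_add]
    rw [← mul_assoc σ.sign, σ.sign_mul_sign]
    positivity

instance Side.neBot_cone (σ : Side) (x : ℝ) : (𝓝[σ.cone 1 x] (x : ℂ)).NeBot :=
  (σ.tendsto_vertical_cone one_pos x).neBot

namespace NontangentialLimit

variable {σ : Side} {F G : ℂ → ℂ} {x : ℝ} {u v : ℂ}

lemma unique (hu : NontangentialLimit σ F x u) (hv : NontangentialLimit σ F x v) : u = v :=
  tendsto_nhds_unique (hu 1 one_pos) (hv 1 one_pos)

lemma congr (hu : NontangentialLimit σ F x u) (h : ∀ z ∈ σ.halfPlane, F z = G z) :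
    NontangentialLimit σ G x u := fun a ha =>
  (hu a ha).congr' (eventually_nhdsWithin_of_forall fun z hz =>
    h z (σ.cone_subset_halfPlane ha x hz))

lemma comp (hu : NontangentialLimit σ F x u) {φ : ℂ → ℂ} (hφ : ContinuousAt φ u) :
    NontangentialLimit σ (fun z => φ (F z)) x (φ u) := fun a ha => hφ.tendsto.comp (hu a ha)

lemma sub (hu : NontangentialLimit σ F x u) (hv : NontangentialLimit σ G x v) :
    NontangentialLimit σ (fun z => F z - G z) x (u - v) := fun a ha => (hu a ha).sub (hv a ha)

lemma mul (hu : NontangentialLimit σ F x u) (hv : NontangentialLimit σ G x v) :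
    NontangentialLimit σ (fun z => F z * G z) x (u * v) := fun a ha => (hu a ha).mul (hv a ha)

lemma div (hu : NontangentialLimit σ F x u) (hv : NontangentialLimit σ G x v) (h : v ≠ 0) :
    NontangentialLimit σ (fun z => F z / G z) x (u / v) := fun a ha => (hu a ha).div (hv a ha) h

lemma of_continuousAt (h : ContinuousAt F x) : NontangentialLimit σ F x (F x) := fun _ _ =>
  h.tendsto.mono_left nhdsWithin_le_nhds

lemma conj (hu : NontangentialLimit σ F x u) :
    NontangentialLimit σ.opp (fun z => (starRingEnd ℂ) (F ((starRingEnd ℂ) z))) x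
      ((starRingEnd ℂ) u) := by
  intro a ha
  refine (Complex.continuous_conj.tendsto u).comp ((hu a ha).comp ?_)
  refine tendsto_nhdsWithin_iff.2 ⟨?_, eventually_nhdsWithin_of_forall fun z hz => ?_⟩
  · have := Complex.continuous_conj.tendsto (x : ℂ)
    rw [Complex.conj_ofReal] at this
    exact this.mono_left nhdsWithin_le_nhds
  · simp only [Side.cone, Set.mem_ofPred_eq, Side.sign_opp] at hz ⊢
    simpa using hz

lemma tendsto_vertical (hu : NontangentialLimit Side.upper F x u) :
    Tendsto (fun n : ℕ => F (x + (1 / ((n : ℝ) + 1) : ℝ) * I)) atTop (𝓝 u) := by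
  simpa [Side.sign, Function.comp_def] using
    (hu 1 one_pos).comp (Side.upper.tendsto_vertical_cone one_pos x)

end NontangentialLimit

/-! ### Logarithms in a half-plane and their boundary limits. -/

lemma Complex.countable_setOf_exp_eq (w : ℂ) : {u : ℂ | Complex.exp u = w}.Countable := by
  rcases Set.eq_empty_or_nonempty {u : ℂ | Complex.exp u = w} with h | ⟨v, hv⟩
  · rw [h]; exact Set.countable_empty
  · refine (Set.countable_range fun n : ℤ => v + n * (2 * Real.pi * I)).mono fun u hu => ?_
    have hu' : Complex.exp u = Complex.exp v := (show Complex.exp u = w from hu).trans hv.symm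
    obtain ⟨n, hn⟩ := Complex.exp_eq_exp_iff_exists_int.1 hu'
    exact ⟨n, hn.symm⟩

/-- A continuous logarithm on a convex set has a limit at a point if its exponential has a nonzero
limit there. -/
lemma exists_tendsto_of_tendsto_exp {K : Set ℂ} (hK : Convex ℝ K) {x : ℂ} {ℓ : ℂ → ℂ}
    (hℓ : ContinuousOn ℓ K) {w : ℂ} (hw : w ≠ 0)
    (h : Tendsto (fun z => Complex.exp (ℓ z)) (𝓝[K] x) (𝓝 w)) :
    ∃ u, Tendsto ℓ (𝓝[K] x) (𝓝 u) := by
  have h1 : Tendsto (fun z => Complex.exp (ℓ z) / w) (𝓝[K] x) (𝓝 1) := by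
    rw [← div_self hw]
    exact h.div_const w
  have h2 : ∀ᶠ z in 𝓝[K] x, Complex.exp (ℓ z) / w ∈ Complex.slitPlane :=
    h1.eventually (Complex.isOpen_slitPlane.mem_nhds Complex.one_mem_slitPlane)
  obtain ⟨ε, hε, hball⟩ := Metric.mem_nhdsWithin_iff.1 h2
  set T := Metric.ball x ε ∩ K
  have hTK : T ∈ 𝓝[K] x := Metric.mem_nhdsWithin_iff.2 ⟨ε, hε, subset_rfl⟩
  -- Near `x`, `N` is a continuous function on a connected set with values in the countable set of
  -- logarithms of `w`, hence constant; the principal logarithm that was subtracted tends to `0`.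
  set N : ℂ → ℂ := fun z => ℓ z - Complex.log (Complex.exp (ℓ z) / w)
  have hNc : ContinuousOn N T := by
    have h3 : ContinuousOn ℓ T := hℓ.mono Set.inter_subset_right
    exact h3.sub (ContinuousOn.clog ((Complex.continuous_exp.comp_continuousOn h3).div_const w)
      fun z hz => hball hz)
  have hN : ∀ z, Complex.exp (N z) = w := by
    intro z
    simp only [N]
    rw [Complex.exp_sub, Complex.exp_log (div_ne_zero (Complex.exp_ne_zero _) hw),
      div_div_cancel₀ (Complex.exp_ne_zero _)]
  have hsub : (N '' T).Subsingleton :=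
    (Complex.countable_setOf_exp_eq w).isTotallyDisconnected _
      (by rintro _ ⟨z, -, rfl⟩; exact hN z)
      ((((convex_ball x ε).inter hK).isPreconnected).image N hNc)
  have hlog : Tendsto (fun z => Complex.log (Complex.exp (ℓ z) / w)) (𝓝[K] x) (𝓝 0) := by
    rw [← Complex.log_one]
    exact h1.clog Complex.one_mem_slitPlane
  rcases T.eq_empty_or_nonempty with hT | ⟨z₀, hz₀⟩
  · refine ⟨0, ?_⟩
    rw [hT, empty_mem_iff_bot] at hTK
    rw [hTK]
    exact tendsto_bot
  · refine ⟨N z₀, ?_⟩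
    have h4 := hlog.const_add (N z₀)
    rw [add_zero] at h4
    refine h4.congr' ?_
    filter_upwards [hTK] with z hz
    rw [hsub ⟨z₀, hz₀, rfl⟩ ⟨z, hz, rfl⟩]
    simp [N]

/-- Each cone is convex, so the previous lemma gives a limit there. The limits for different
apertures agree because the cones are nested. -/
lemma exists_nontangentialLimit_of_exp {σ : Side} {ℓ : ℂ → ℂ} (hℓ : ContinuousOn ℓ σ.halfPlane)
    {x : ℝ} {w : ℂ} (hw : w ≠ 0) (h : NontangentialLimit σ (fun z => Complex.exp (ℓ z)) x w) :
    ∃ u, NontangentialLimit σ ℓ x u := by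
  have key : ∀ a : ℝ, 0 < a → ∃ u, Tendsto ℓ (𝓝[σ.cone a x] (x : ℂ)) (𝓝 u) := fun a ha =>
    exists_tendsto_of_tendsto_exp (σ.convex_cone x) (hℓ.mono (σ.cone_subset_halfPlane ha x)) hw (h a ha)
  obtain ⟨u, hu⟩ := key 1 one_pos
  refine ⟨u, fun a ha => ?_⟩
  obtain ⟨v, hv⟩ := key (max a 1) (lt_max_of_lt_right one_pos)
  have huv : u = v := tendsto_nhds_unique hu
    (hv.mono_left (nhdsWithin_mono _ (σ.cone_mono one_pos (le_max_right _ _) x)))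
  rw [huv]
  exact hv.mono_left (nhdsWithin_mono _ (σ.cone_mono ha (le_max_left _ _) x))

/-- Analytic logarithms of functions without zeros exist in a half-plane. -/
lemma Side.exists_log (σ : Side) {G : ℂ → ℂ} (hG : DifferentiableOn ℂ G σ.halfPlane)
    (h0 : ∀ z ∈ σ.halfPlane, G z ≠ 0) :
    ∃ ℓ : ℂ → ℂ, DifferentiableOn ℂ ℓ σ.halfPlane ∧ ∀ z ∈ σ.halfPlane, Complex.exp (ℓ z) = G z := by
  have hne : σ.halfPlane.Nonempty := ⟨(σ.sign : ℂ) * I, by simp [Side.halfPlane, σ.sign_mul_sign]⟩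
  have hsc : IsSimplyConnected σ.halfPlane := by
    have := σ.convex_halfPlane.contractibleSpace hne
    exact (inferInstance : SimplyConnectedSpace σ.halfPlane)
  obtain ⟨ℓ, hc, he⟩ := Complex.exists_continuousOn_eqOn_exp_comp hsc σ.isOpen_halfPlane
    hG.continuousOn (by rintro ⟨z, hz, hz0⟩; exact h0 z hz hz0)
  refine ⟨ℓ, fun z₀ hz₀ => ?_, he⟩
  refine DifferentiableAt.differentiableWithinAt ?_
  have hnhds := σ.isOpen_halfPlane.mem_nhds hz₀
  have hcz : ContinuousAt ℓ z₀ := hc.continuousAt hnhds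
  -- By continuity `ℓ z - ℓ z₀` has imaginary part below `π` in absolute value near `z₀`, so `ℓ`
  -- coincides there with this analytic function.
  have h1 : DifferentiableAt ℂ (fun z => ℓ z₀ + Complex.log (G z / G z₀)) z₀ := by
    refine ((DifferentiableAt.clog ((hG.differentiableAt hnhds).div_const _) ?_)).const_add _
    rw [div_self (h0 z₀ hz₀)]
    exact Complex.one_mem_slitPlane
  refine h1.congr_of_eventuallyEq ?_
  have h2 : ∀ᶠ z in 𝓝 z₀, |(ℓ z - ℓ z₀).im| < Real.pi := by
    have h3 : ContinuousAt (fun z => |(ℓ z - ℓ z₀).im|) z₀ :=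
      (Complex.continuous_im.continuousAt.comp (hcz.sub continuousAt_const)).abs
    refine h3.eventually_lt_const ?_
    simpa using Real.pi_pos
  filter_upwards [h2, hnhds] with z hz hzm
  have e1 : G z / G z₀ = Complex.exp (ℓ z - ℓ z₀) := by
    rw [Complex.exp_sub]
    exact congrArg₂ (· / ·) (he hzm).symm (he hz₀).symm
  rw [e1, Complex.log_exp (abs_lt.1 hz).1 (abs_lt.1 hz).2.le]
  ring

/-! ### Change of formulation for Hardy spaces, and reflection in the real line. -/

section Hardy

lemma IsHardyExtension.upperHardy {q : ℝ} (hq : 0 < q) {F : ℂ → ℂ} {f : ℝ → ℂ}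
    (h : IsHardyExtension Side.upper (ENNReal.ofReal q) F f) : UpperHardy q F f where
  differentiableOn := Side.upper_halfPlane ▸ h.analytic
  means := by
    obtain ⟨M, hM⟩ := h.bounded_means
    refine ⟨(M : ENNReal) ^ q, ENNReal.rpow_ne_top_of_nonneg hq.le ENNReal.coe_ne_top,
      fun y hy => ?_⟩
    have h1 := hM y hy
    rw [eLpNorm_eq_lintegral_rpow_enorm_toReal (by simpa using hq) ENNReal.ofReal_ne_top,
      ENNReal.toReal_ofReal hq.le] at h1
    have h2 := ENNReal.rpow_le_rpow h1 hq.le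
    rw [← ENNReal.rpow_mul, one_div, inv_mul_cancel₀ hq.ne', ENNReal.rpow_one] at h2
    simpa [Side.sign] using h2
  boundary := h.boundary.mono fun _ hx => hx.tendsto_vertical

lemma UpperHardy.isHardyExtension {q : ℝ} (hq : 0 < q) {F : ℂ → ℂ} {f : ℝ → ℂ}
    (h : UpperHardy q F f) (hb : ∀ᵐ x : ℝ, NontangentialLimit Side.upper F x (f x)) :
    IsHardyExtension Side.upper (ENNReal.ofReal q) F f where
  analytic := Side.upper_halfPlane.symm ▸ h.differentiableOn
  bounded_means := by
    obtain ⟨M, hM, hMb⟩ := h.means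
    refine ⟨(M ^ (1 / q)).toNNReal, fun y hy => ?_⟩
    rw [ENNReal.coe_toNNReal (ENNReal.rpow_ne_top_of_nonneg (by positivity) hM),
      eLpNorm_eq_lintegral_rpow_enorm_toReal (by simpa using hq) ENNReal.ofReal_ne_top,
      ENNReal.toReal_ofReal hq.le]
    refine ENNReal.rpow_le_rpow ?_ (by positivity)
    simpa [Side.sign] using hMb y hy
  boundary := hb

lemma UpperHardy.memLp {q : ℝ} (hq : 0 < q) {F : ℂ → ℂ} {f : ℝ → ℂ} (h : UpperHardy q F f) :
    MemLp f (ENNReal.ofReal q) volume := by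
  refine ⟨h.aestronglyMeasurable, ?_⟩
  rw [eLpNorm_lt_top_iff_lintegral_rpow_enorm_lt_top (by simpa using hq) ENNReal.ofReal_ne_top,
    ENNReal.toReal_ofReal hq.le]
  exact h.lintegral_ne_top.lt_top

/-- The map `F ↦ conj (F (conj z))` preserves analyticity and moduli on lines. Through it, the lower
half-plane is handled by the results for the upper one. -/
lemma IsHardyExtension.conj {σ : Side} {p : ENNReal} {F : ℂ → ℂ} {f : ℝ → ℂ}
    (h : IsHardyExtension σ p F f) :
    IsHardyExtension σ.opp p (fun z => (starRingEnd ℂ) (F ((starRingEnd ℂ) z)))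
      (fun x => (starRingEnd ℂ) (f x)) where
  analytic := by
    intro z hz
    refine DifferentiableAt.differentiableWithinAt ?_
    have hz' : (starRingEnd ℂ) z ∈ σ.halfPlane := by
      simp only [Side.halfPlane, Set.mem_ofPred_eq, Side.sign_opp] at hz ⊢
      simpa using hz
    have := (h.analytic.differentiableAt (σ.isOpen_halfPlane.mem_nhds hz')).conj_conj
    simpa [Function.comp_def] using this
  bounded_means := by
    obtain ⟨M, hM⟩ := h.bounded_means
    refine ⟨M, fun y hy => (le_of_eq ?_).trans (hM y hy)⟩
    refine eLpNorm_congr_norm_ae (Eventually.of_forall fun x => ?_)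
    simp [Side.sign_opp]
  boundary := h.boundary.mono fun x hx => hx.conj

lemma MemHardy.conj {σ : Side} {p : ENNReal} {f : ℝ → ℂ} (h : MemHardy σ p f) :
    MemHardy σ.opp p fun x => (starRingEnd ℂ) (f x) := by
  obtain ⟨h1, F, hF⟩ := h
  refine ⟨⟨Complex.continuous_conj.comp_aestronglyMeasurable h1.1, ?_⟩, _, hF.conj⟩
  rw [eLpNorm_congr_norm_ae (g := f) (Eventually.of_forall fun x => by simp)]
  exact h1.2

lemma lintegral_rpow_inv_norm_add_I_ne_top {q : ℝ} (hq : 1 < q) (a : ℂ) :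
    ∫⁻ x : ℝ, ‖a / ((x : ℂ) + I)‖ₑ ^ q ≠ ⊤ := by
  have hfin := finite_integral_one_add_norm (E := ℝ) (μ := volume) (r := q) (by simpa using hq)
  have hb : ∀ x : ℝ, ‖a / ((x : ℂ) + I)‖ₑ ^ q ≤
      ENNReal.ofReal ((‖a‖ * 2) ^ q) * ENNReal.ofReal ((1 + ‖x‖) ^ (-q)) := by
    intro x
    have h0 : 0 < 1 + ‖x‖ := by positivity
    have h1 : 1 + ‖x‖ ≤ 2 * ‖(x : ℂ) + I‖ := by
      have := one_le_norm_add_I (z := x) (by simp)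
      have h2 : ‖x‖ ≤ ‖(x : ℂ) + I‖ := by simpa using Complex.abs_re_le_norm ((x : ℂ) + I)
      linarith
    have h3 : 0 < ‖(x : ℂ) + I‖ := by linarith
    rw [← ofReal_norm, ENNReal.ofReal_rpow_of_nonneg (norm_nonneg _) (by linarith),
      ← ENNReal.ofReal_mul (by positivity)]
    refine ENNReal.ofReal_le_ofReal ?_
    rw [Real.rpow_neg h0.le, ← Real.inv_rpow h0.le, ← Real.mul_rpow (by positivity) (by positivity)]
    refine Real.rpow_le_rpow (norm_nonneg _) ?_ (by linarith)
    rw [norm_div, ← div_eq_mul_inv, div_le_div_iff₀ h3 h0]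
    nlinarith [norm_nonneg a]
  refine ne_top_of_le_ne_top ?_ (lintegral_mono hb)
  rw [lintegral_const_mul' _ _ ENNReal.ofReal_ne_top]
  exact ENNReal.mul_ne_top ENNReal.ofReal_ne_top hfin.ne

lemma norm_add_I_le_shift {y : ℝ} (hy : 0 ≤ y) {z : ℂ} (hz : 0 ≤ z.im) :
    ‖z + I‖ ≤ ‖z + y * I + I‖ := by
  refine le_of_sq_le_sq ?_ (norm_nonneg _)
  rw [← Complex.normSq_eq_norm_sq, ← Complex.normSq_eq_norm_sq]
  simp only [Complex.normSq_apply, Complex.add_re, Complex.add_im, Complex.mul_re, Complex.mul_im,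
    Complex.ofReal_re, Complex.ofReal_im, Complex.I_re, Complex.I_im]
  nlinarith [mul_nonneg hy hz]

lemma add_I_ne_zero {z : ℂ} (hz : 0 ≤ z.im) : z + I ≠ 0 :=
  norm_pos_iff.1 (zero_lt_one.trans_le (one_le_norm_add_I hz))

/-- Constants thus belong to the weighted Hardy spaces. With `a = 1` this is also the second factor
that turns the product formula into one for a single function. -/
lemma upperHardy_const_div {q : ℝ} (hq : 1 < q) (a : ℂ) :
    UpperHardy q (fun z => a / (z + I)) fun t => a / ((t : ℂ) + I) where
  differentiableOn := by
    intro z hz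
    have := add_I_ne_zero (le_of_lt (show 0 < z.im from hz))
    fun_prop (disch := assumption)
  means := by
    refine ⟨_, lintegral_rpow_inv_norm_add_I_ne_top hq a, fun y hy => lintegral_mono fun x => ?_⟩
    refine ENNReal.rpow_le_rpow ?_ (by linarith)
    rw [← ofReal_norm, ← ofReal_norm, norm_div, norm_div]
    have h1 := norm_add_I_le_shift hy.le (z := x) (by simp)
    have h2 := one_le_norm_add_I (z := x) (by simp)
    exact ENNReal.ofReal_le_ofReal (by gcongr)
  boundary := by
    refine Eventually.of_forall fun x => ?_
    have hc : ContinuousAt (fun z : ℂ => a / (z + I)) (x : ℂ) := by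
      have := add_I_ne_zero (z := x) (by simp)
      fun_prop (disch := assumption)
    exact hc.tendsto.comp (_root_.tendsto_vertical (x : ℂ))

end Hardy

/-! ### Control of an analytic function in the mean square by its real part. -/

lemma halfPlanePoisson_eq_im (w : ℂ) (τ : ℝ) :
    halfPlanePoisson w τ = 1 / Real.pi * (1 / ((τ : ℂ) - w)).im := by
  simp only [halfPlanePoisson, one_div, Complex.inv_im, Complex.sub_im, Complex.ofReal_im]
  ring

/-- The harmonic measure composed with an analytic map is harmonic: mean value property of the
Poisson kernel. -/
lemma integral_halfPlanePoisson_mul_comp {S : ℂ → ℂ}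
    (hS : ∀ z : ℂ, 0 ≤ z.im → DifferentiableAt ℂ S z) {δ : ℝ} (hδ : 0 < δ)
    (hSδ : ∀ z : ℂ, 0 ≤ z.im → δ ≤ (S z).im) {w : ℂ} (hw : 0 < w.im) (τ : ℝ) :
    ∫ x : ℝ, halfPlanePoisson w x * halfPlanePoisson (S x) τ = halfPlanePoisson (S w) τ := by
  have hne : ∀ z : ℂ, 0 ≤ z.im → (τ : ℂ) - S z ≠ 0 := fun z hz =>
    ofReal_sub_ne_zero (hδ.trans_le (hSδ z hz)).ne' τ
  have hd : ∀ z : ℂ, 0 ≤ z.im → DifferentiableAt ℂ (fun z => 1 / ((τ : ℂ) - S z)) z := by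
    intro z hz
    have h1 := hne z hz
    have h2 := hS z hz
    fun_prop (disch := assumption)
  have hb : ∀ z : ℂ, 0 ≤ z.im → ‖1 / ((τ : ℂ) - S z)‖ ≤ 1 / δ := by
    intro z hz
    rw [norm_div, norm_one]
    refine one_div_le_one_div_of_le hδ ((hSδ z hz).trans ?_)
    refine le_trans ?_ (Complex.abs_im_le_norm _)
    simpa using le_abs_self (S z).im
  have h := integral_halfPlanePoisson_mul_of_bounded hd hb hw
  have hint : Integrable fun x : ℝ => (halfPlanePoisson w x : ℂ) * (1 / ((τ : ℂ) - S x)) := by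
    refine (integrable_halfPlanePoisson hw).ofReal.mul_bdd (c := 1 / δ) ?_ ?_
    · refine Continuous.aestronglyMeasurable ?_
      exact continuous_iff_continuousAt.2 fun t =>
        ContinuousAt.comp (f := fun t : ℝ => (t : ℂ)) (hd t (by simp)).continuousAt
          Complex.continuous_ofReal.continuousAt
    · exact Eventually.of_forall fun t => hb t (by simp)
  have h2 := Complex.imCLM.integral_comp_comm hint
  rw [h] at h2
  simp only [Complex.imCLM_apply, Complex.im_ofReal_mul] at h2
  rw [halfPlanePoisson_eq_im, ← h2, ← integral_const_mul]
  refine integral_congr_ae (Eventually.of_forall fun x => ?_)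
  simp only [halfPlanePoisson_eq_im (S x)]
  ring

/-- By Tonelli this reduces to the mean value property of each kernel `halfPlanePoisson (S ·) t`,
the imaginary part of a bounded analytic function up to a factor. -/
lemma lintegral_lintegral_poissonMeasure_comp {S : ℂ → ℂ}
    (hS : ∀ z : ℂ, 0 ≤ z.im → DifferentiableAt ℂ S z) {δ : ℝ} (hδ : 0 < δ)
    (hSδ : ∀ z : ℂ, 0 ≤ z.im → δ ≤ (S z).im) {w : ℂ} (hw : 0 < w.im) {m : ℝ → ENNReal}
    (hm : AEMeasurable m) :
    ∫⁻ x : ℝ, ∫⁻ t, m t ∂poissonMeasure (S x) ∂poissonMeasure w =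
      ∫⁻ t, m t ∂poissonMeasure (S w) := by
  have hSm : Measurable fun x : ℝ => S x := by
    refine Continuous.measurable (continuous_iff_continuousAt.2 fun t => ?_)
    exact ContinuousAt.comp (f := fun t : ℝ => (t : ℂ)) (hS t (by simp)).continuousAt
      Complex.continuous_ofReal.continuousAt
  have hpos : ∀ x τ : ℝ, 0 ≤ halfPlanePoisson (S x) τ := fun x τ =>
    (halfPlanePoisson_pos (hδ.trans_le (hSδ x (by simp))) τ).le
  simp_rw [lintegral_poissonMeasure]
  have h1 : ∀ x : ℝ, ENNReal.ofReal (halfPlanePoisson w x) *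
      ∫⁻ t, ENNReal.ofReal (halfPlanePoisson (S x) t) * m t =
      ∫⁻ t, ENNReal.ofReal (halfPlanePoisson w x * halfPlanePoisson (S x) t) * m t := by
    intro x
    rw [← lintegral_const_mul' _ _ ENNReal.ofReal_ne_top]
    refine lintegral_congr fun t => ?_
    rw [ENNReal.ofReal_mul (halfPlanePoisson_pos hw x).le, mul_assoc]
  simp_rw [h1]
  have hmeas : Measurable fun p : ℝ × ℝ =>
      ENNReal.ofReal (halfPlanePoisson w p.1 * halfPlanePoisson (S p.1) p.2) := by
    refine Measurable.ennreal_ofReal (Measurable.mul ?_ ?_)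
    · exact measurable_halfPlanePoisson.comp (measurable_const.prodMk measurable_fst)
    · exact measurable_halfPlanePoisson.comp ((hSm.comp measurable_fst).prodMk measurable_snd)
  rw [lintegral_lintegral_swap (hmeas.aemeasurable.mul hm.comp_snd)]
  refine lintegral_congr fun t => ?_
  have hmeas' : Measurable fun x : ℝ =>
      ENNReal.ofReal (halfPlanePoisson w x * halfPlanePoisson (S x) t) :=
    ((continuous_halfPlanePoisson hw).measurable.mul
      (measurable_halfPlanePoisson.comp (hSm.prodMk measurable_const))).ennreal_ofReal
  rw [lintegral_mul_const _ hmeas']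
  congr 1
  have h2 := integral_halfPlanePoisson_mul_comp hS hδ hSδ hw t
  have h3 : 0 < halfPlanePoisson (S w) t :=
    halfPlanePoisson_pos (hδ.trans_le (hSδ w hw.le)) t
  rw [← h2, ofReal_integral_eq_lintegral_ofReal]
  · exact Integrable.of_integral_ne_zero (by rw [h2]; exact h3.ne')
  · exact Eventually.of_forall fun x => mul_nonneg (halfPlanePoisson_pos hw x).le (hpos x t)

/-- The Möbius transformations of the upper half-plane that fix `i` and, for `0 < s`, map the upper
half-plane onto a disc relatively compact in it. -/
noncomputable def moebiusShrink (s : ℝ) (z : ℂ) : ℂ := (z + s * I) / (1 - s * I * z)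

lemma moebiusShrink_denom_ne_zero {s : ℝ} (hs : 0 ≤ s) {z : ℂ} (hz : 0 ≤ z.im) :
    1 - s * I * z ≠ 0 := by
  intro h
  have h1 := congrArg Complex.re h
  simp at h1
  nlinarith [mul_nonneg hs hz]

lemma moebiusShrink_I {s : ℝ} (hs : 0 ≤ s) : moebiusShrink s I = I := by
  have h := moebiusShrink_denom_ne_zero hs (z := I) (by simp)
  rw [moebiusShrink, div_eq_iff h]
  linear_combination (s * I) * Complex.I_mul_I

lemma differentiableAt_moebiusShrink {s : ℝ} (hs : 0 ≤ s) {z : ℂ} (hz : 0 ≤ z.im) :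
    DifferentiableAt ℂ (moebiusShrink s) z := by
  have h := moebiusShrink_denom_ne_zero hs hz
  unfold moebiusShrink
  fun_prop (disch := assumption)

/-- Together with `norm_moebiusShrink_le`, this confines the image to a compact subset of the open
half-plane when `0 < s`, where every function analytic in the half-plane is bounded. -/
lemma le_im_moebiusShrink {s : ℝ} (hs : 0 ≤ s) (hs1 : s ≤ 1) {z : ℂ} (hz : 0 ≤ z.im) :
    s ≤ (moebiusShrink s z).im := by
  have h := Complex.normSq_pos.2 (moebiusShrink_denom_ne_zero hs hz)
  rw [moebiusShrink, Complex.div_im, div_sub_div_same, le_div_iff₀ h]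
  simp only [Complex.normSq_apply, Complex.sub_re, Complex.sub_im, Complex.add_re, Complex.add_im,
    Complex.mul_re, Complex.mul_im, Complex.ofReal_re, Complex.ofReal_im, Complex.I_re,
    Complex.I_im, Complex.one_re, Complex.one_im]
  have h1 : 0 ≤ 1 - s ^ 2 := by nlinarith
  nlinarith [mul_nonneg h1 hz, mul_nonneg (mul_nonneg h1 hs) (sq_nonneg z.re),
    mul_nonneg (mul_nonneg h1 hs) (sq_nonneg z.im)]

lemma norm_moebiusShrink_le {s : ℝ} (hs : 0 < s) (hs1 : s ≤ 1) {z : ℂ} (hz : 0 ≤ z.im) :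
    ‖moebiusShrink s z‖ ≤ 1 / s := by
  have h := norm_pos_iff.2 (moebiusShrink_denom_ne_zero hs.le hz)
  rw [moebiusShrink, norm_div, div_le_div_iff₀ h hs, one_mul]
  refine le_of_sq_le_sq ?_ (norm_nonneg _)
  rw [mul_pow, ← Complex.normSq_eq_norm_sq, ← Complex.normSq_eq_norm_sq]
  simp only [Complex.normSq_apply, Complex.sub_re, Complex.sub_im, Complex.add_re, Complex.add_im,
    Complex.mul_re, Complex.mul_im, Complex.ofReal_re, Complex.ofReal_im, Complex.I_re,
    Complex.I_im, Complex.one_re, Complex.one_im]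
  have h1 : 0 ≤ 1 - s ^ 2 := by nlinarith
  have h2 : 0 ≤ s * z.im := by positivity
  nlinarith [mul_nonneg h1 h2, sq_nonneg s]

lemma tendsto_moebiusShrink (z : ℂ) {s : ℕ → ℝ} (hs : Tendsto s atTop (𝓝 0)) :
    Tendsto (fun n => moebiusShrink (s n) z) atTop (𝓝 z) := by
  have hsc : Tendsto (fun n => (s n : ℂ)) atTop (𝓝 0) := by
    rw [← Complex.ofReal_zero]
    exact (Complex.continuous_ofReal.tendsto 0).comp hs
  have h1 : Tendsto (fun n => z + s n * I) atTop (𝓝 z) := by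
    simpa using (hsc.mul_const I).const_add z
  have h2 : Tendsto (fun n => 1 - s n * I * z) atTop (𝓝 1) := by
    simpa using ((hsc.mul_const I).mul_const z).const_sub 1
  have h3 := h1.div h2 one_ne_zero
  rw [div_one] at h3
  exact h3

/-- The mean square of a bounded analytic function on the real line, for the harmonic measure at `i`,
is controlled by the mean square of its real part. -/
lemma lintegral_enorm_sq_le_of_re {F : ℂ → ℂ} {B : ℝ}
    (hF : ∀ z : ℂ, 0 ≤ z.im → DifferentiableAt ℂ F z) (hB : ∀ z : ℂ, 0 ≤ z.im → ‖F z‖ ≤ B) :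
    ∫⁻ t : ℝ, ‖F t‖ₑ ^ (2 : ℝ) ∂poissonMeasure I ≤
      2 * ∫⁻ t : ℝ, ENNReal.ofReal ((F t).re ^ 2) ∂poissonMeasure I + ‖F I‖ₑ ^ (2 : ℝ) := by
  have hI : 0 < I.im := by simp
  have hprob := isProbabilityMeasure_poissonMeasure hI
  have hcont : Continuous fun t : ℝ => F t := continuous_iff_continuousAt.2 fun t =>
    ContinuousAt.comp (f := fun t : ℝ => (t : ℂ)) (hF t (by simp)).continuousAt
      Complex.continuous_ofReal.continuousAt
  have hB' : ∀ t : ℝ, ‖F t‖ ≤ B := fun t => hB t (by simp)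
  have hB0 : 0 ≤ B := (norm_nonneg _).trans (hB' 0)
  have h1 := integral_halfPlanePoisson_mul_of_bounded (F := fun z => F z ^ 2) (B := B ^ 2)
    (fun z hz => (hF z hz).pow 2) (fun z hz => by
      rw [norm_pow]; exact pow_le_pow_left₀ (norm_nonneg _) (hB z hz) 2) hI
  rw [← integral_poissonMeasure hI] at h1
  have i1 : Integrable (fun t : ℝ => F t ^ 2) (poissonMeasure I) :=
    Integrable.of_bound (hcont.pow 2).aestronglyMeasurable (B ^ 2) (Eventually.of_forall fun t => by
      rw [norm_pow]; exact pow_le_pow_left₀ (norm_nonneg _) (hB' t) 2)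
  have i2 : Integrable (fun t : ℝ => (F t).re ^ 2) (poissonMeasure I) :=
    Integrable.of_bound ((Complex.continuous_re.comp hcont).pow 2).aestronglyMeasurable (B ^ 2)
      (Eventually.of_forall fun t => by
        rw [norm_pow]
        exact pow_le_pow_left₀ (norm_nonneg _) ((Complex.abs_re_le_norm _).trans (hB' t)) 2)
  have h2 := Complex.reCLM.integral_comp_comm i1
  rw [h1] at h2
  simp only [Complex.reCLM_apply] at h2
  -- The last term integrates to `Re (F I)²`, by Poisson's formula for `F²`.
  have h3 : ∀ t : ℝ, ‖F t‖ ^ 2 = 2 * (F t).re ^ 2 - (F t ^ 2).re := by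
    intro t
    rw [← Complex.normSq_eq_norm_sq, Complex.normSq_apply, pow_two (F t), Complex.mul_re]
    ring
  have h4 : ∫ t : ℝ, ‖F t‖ ^ 2 ∂poissonMeasure I ≤
      2 * ∫ t : ℝ, (F t).re ^ 2 ∂poissonMeasure I + ‖F I‖ ^ 2 := by
    simp_rw [h3]
    have i4 : Integrable (fun t : ℝ => (F t ^ 2).re) (poissonMeasure I) := i1.re
    rw [integral_sub (i2.const_mul 2) i4, h2, integral_const_mul]
    have := Complex.abs_re_le_norm (F I ^ 2)
    rw [norm_pow] at this
    have := neg_abs_le (F I ^ 2).re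
    linarith
  have i3 : Integrable (fun t : ℝ => ‖F t‖ ^ 2) (poissonMeasure I) := by
    simp_rw [← norm_pow]; exact i1.norm
  have e1 : ∀ z : ℂ, ‖z‖ₑ ^ (2 : ℝ) = ENNReal.ofReal (‖z‖ ^ 2) := by
    intro z
    rw [← ofReal_norm, ENNReal.ofReal_rpow_of_nonneg (norm_nonneg _) zero_le_two, Real.rpow_two]
  simp_rw [e1]
  rw [← ofReal_integral_eq_lintegral_ofReal i3 (Eventually.of_forall fun t => by positivity),
    ← ofReal_integral_eq_lintegral_ofReal i2 (Eventually.of_forall fun t => by positivity)]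
  refine (ENNReal.ofReal_le_ofReal h4).trans ?_
  rw [ENNReal.ofReal_add (mul_nonneg zero_le_two (integral_nonneg fun t => by positivity))
    (by positivity), ENNReal.ofReal_mul zero_le_two]
  simp

/-- A Harnack inequality: the kernel at `a i` is `a / (π (t² + a²))`, and `a² ≥ 1`. -/
lemma lintegral_poissonMeasure_mul_I_le {a : ℝ} (ha : 1 ≤ a) (m : ℝ → ENNReal) :
    ∫⁻ t, m t ∂poissonMeasure (a * I) ≤ ENNReal.ofReal a * ∫⁻ t, m t ∂poissonMeasure I := by
  rw [lintegral_poissonMeasure, lintegral_poissonMeasure,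
    ← lintegral_const_mul' _ _ ENNReal.ofReal_ne_top]
  refine lintegral_mono fun t => ?_
  rw [← mul_assoc, ← ENNReal.ofReal_mul (by linarith)]
  gcongr
  rw [halfPlanePoisson_I, halfPlanePoisson]
  simp only [Complex.normSq_apply, Complex.sub_re, Complex.sub_im, Complex.mul_re, Complex.mul_im,
    Complex.ofReal_re, Complex.ofReal_im, Complex.I_re, Complex.I_im]
  have := Real.pi_pos
  rw [← mul_div_assoc, ← mul_div_assoc, mul_one, zero_mul, add_zero]
  exact div_le_div_of_nonneg_left (by positivity) (by positivity) (by nlinarith)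

/-- The means over horizontal lines of a bounded analytic function, with the weight
`|z + i|⁻²`. -/
lemma lintegral_div_add_I_le {F : ℂ → ℂ} {B : ℝ}
    (hF : ∀ z : ℂ, 0 ≤ z.im → DifferentiableAt ℂ F z) (hB : ∀ z : ℂ, 0 ≤ z.im → ‖F z‖ ≤ B)
    {y : ℝ} (hy : 0 < y) :
    ∫⁻ x : ℝ, ‖F (x + y * I) / (x + y * I + I)‖ₑ ^ (2 : ℝ) ≤
      ENNReal.ofReal (2 * Real.pi) * ∫⁻ t : ℝ, ‖F t‖ₑ ^ (2 : ℝ) ∂poissonMeasure I := by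
  have hpi := Real.pi_pos
  have hcont : Continuous fun t : ℝ => F t := continuous_iff_continuousAt.2 fun t =>
    ContinuousAt.comp (f := fun t : ℝ => (t : ℂ)) (hF t (by simp)).continuousAt
      Complex.continuous_ofReal.continuousAt
  have hw : 0 < (((1 + y : ℝ) : ℂ) * I).im := by simp; linarith
  -- The weight `|x + iy + i|⁻²` is itself a Poisson kernel, with pole `(1 + y) i`.
  have h1 : ∀ x : ℝ, ‖F (x + y * I) / (x + y * I + I)‖ₑ ^ (2 : ℝ) =
      ENNReal.ofReal (Real.pi / (1 + y)) *
        (ENNReal.ofReal (halfPlanePoisson ((1 + y : ℝ) * I) x) * ‖F (x + y * I)‖ₑ ^ (2 : ℝ)) := by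
    intro x
    rw [← mul_assoc, ← ENNReal.ofReal_mul (by positivity), ← ofReal_norm, ← ofReal_norm,
      ENNReal.ofReal_rpow_of_nonneg (norm_nonneg _) zero_le_two,
      ENNReal.ofReal_rpow_of_nonneg (norm_nonneg _) zero_le_two,
      ← ENNReal.ofReal_mul (mul_nonneg (by positivity) (halfPlanePoisson_pos hw x).le)]
    congr 1
    rw [norm_div, Real.rpow_two, Real.rpow_two, div_pow, halfPlanePoisson]
    have e : Complex.normSq ((x : ℂ) - ((1 + y : ℝ) : ℂ) * I) = ‖(x : ℂ) + y * I + I‖ ^ 2 := by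
      rw [← Complex.normSq_eq_norm_sq]
      simp [Complex.normSq_apply]
      ring
    have e2 : ‖(x : ℂ) + y * I + I‖ ≠ 0 := by
      rw [norm_ne_zero_iff]
      exact add_I_ne_zero (by simpa using hy.le)
    rw [e]
    simp only [Complex.mul_im, Complex.ofReal_re, Complex.ofReal_im, Complex.I_re, Complex.I_im]
    have e3 : (1 + y) ≠ 0 := by positivity
    field_simp
    ring
  simp_rw [h1]
  rw [lintegral_const_mul' _ _ ENNReal.ofReal_ne_top, ← lintegral_poissonMeasure]
  have h2 : ∀ x : ℝ, ‖F (x + y * I)‖ₑ ^ (2 : ℝ) ≤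
      ∫⁻ t : ℝ, ‖F t‖ₑ ^ (2 : ℝ) ∂poissonMeasure (x + y * I) := by
    intro x
    have hx : 0 < ((x : ℂ) + y * I).im := by simpa using hy
    rw [← integral_halfPlanePoisson_mul_of_bounded hF hB hx, ← integral_poissonMeasure hx]
    exact enorm_integral_poissonMeasure_rpow_le one_le_two hcont.aestronglyMeasurable hx
  -- Averaging the harmonic measures at `x + iy` with respect to that at `(1 + y) i` gives the one
  -- at `(1 + 2y) i`. The final constant comes from `π (1 + 2y) / (1 + y) ≤ 2π`.
  have h3 := lintegral_lintegral_poissonMeasure_comp (S := fun z => z + y * I) (δ := y)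
    (fun z _ => by fun_prop) hy (fun z hz => by simpa using hz) hw
    (m := fun t : ℝ => ‖F t‖ₑ ^ (2 : ℝ)) (hcont.measurable.enorm.pow_const _).aemeasurable
  have h4 := lintegral_poissonMeasure_mul_I_le (a := 1 + 2 * y) (by linarith)
    (fun t : ℝ => ‖F t‖ₑ ^ (2 : ℝ))
  have e5 : ((1 + y : ℝ) : ℂ) * I + y * I = ((1 + 2 * y : ℝ) : ℂ) * I := by push_cast; ring
  rw [e5] at h3
  calc ENNReal.ofReal (Real.pi / (1 + y)) *
        ∫⁻ x : ℝ, ‖F (x + y * I)‖ₑ ^ (2 : ℝ) ∂poissonMeasure ((1 + y : ℝ) * I)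
      ≤ ENNReal.ofReal (Real.pi / (1 + y)) * (ENNReal.ofReal (1 + 2 * y) *
          ∫⁻ t : ℝ, ‖F t‖ₑ ^ (2 : ℝ) ∂poissonMeasure I) := by
        gcongr
        exact (lintegral_mono h2).trans (h3.le.trans h4)
    _ ≤ _ := by
        rw [← mul_assoc, ← ENNReal.ofReal_mul (by positivity)]
        refine mul_le_mul_left (ENNReal.ofReal_le_ofReal ?_) _
        rw [div_mul_eq_mul_div, div_le_iff₀ (by positivity)]
        nlinarith

/-- An analytic function whose real part has a square with a harmonic majorant satisfies the mean
value condition of the Hardy space `H²`, after division by `z + i`. -/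
theorem exists_means_of_re_sq_le {ℓ : ℂ → ℂ} (hℓ : DifferentiableOn ℂ ℓ {z | 0 < z.im})
    {m : ℝ → ENNReal} (hm : AEMeasurable m) (hmI : ∫⁻ t, m t ∂poissonMeasure I ≠ ⊤)
    (hre : ∀ z : ℂ, 0 < z.im → ENNReal.ofReal ((ℓ z).re ^ 2) ≤ ∫⁻ t, m t ∂poissonMeasure z) :
    ∃ M : ENNReal, M ≠ ⊤ ∧ ∀ y : ℝ, 0 < y →
      ∫⁻ x : ℝ, ‖ℓ (x + y * I) / (x + y * I + I)‖ₑ ^ (2 : ℝ) ≤ M := by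
  set M : ENNReal := ENNReal.ofReal (2 * Real.pi) *
    (2 * ∫⁻ t, m t ∂poissonMeasure I + ‖ℓ I‖ₑ ^ (2 : ℝ))
  have hM : M ≠ ⊤ := by
    refine ENNReal.mul_ne_top ENNReal.ofReal_ne_top (ENNReal.add_ne_top.2
      ⟨ENNReal.mul_ne_top (by simp) hmI, ENNReal.rpow_ne_top_of_nonneg zero_le_two enorm_ne_top⟩)
  -- Since `moebiusShrink s` fixes `i`, both the majorant and the value of `ℓ` at `i` are unchanged
  -- by the composition. The bound `M` is therefore independent of `s`, and Fatou's lemma applies as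
  -- `s` tends to `0`.
  have hs : ∀ s : ℝ, 0 < s → s ≤ 1 → ∀ y : ℝ, 0 < y →
      ∫⁻ x : ℝ, ‖ℓ (moebiusShrink s (x + y * I)) / (x + y * I + I)‖ₑ ^ (2 : ℝ) ≤ M := by
    intro s hs hs1 y hy
    have hI : 0 < I.im := by simp
    have hK : IsCompact ({z : ℂ | s ≤ z.im} ∩ Metric.closedBall 0 (1 / s)) :=
      (isCompact_closedBall 0 (1 / s)).inter_left (isClosed_le continuous_const Complex.continuous_im)
    obtain ⟨B, hB⟩ := hK.exists_bound_of_continuousOn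
      (hℓ.continuousOn.mono fun z hz => lt_of_lt_of_le hs hz.1)
    have hd : ∀ z : ℂ, 0 ≤ z.im → DifferentiableAt ℂ (fun z => ℓ (moebiusShrink s z)) z := by
      intro z hz
      have h1 : moebiusShrink s z ∈ {z : ℂ | 0 < z.im} := hs.trans_le (le_im_moebiusShrink hs.le hs1 hz)
      exact (hℓ.differentiableAt (isOpen_upper.mem_nhds h1)).comp z
        (differentiableAt_moebiusShrink hs.le hz)
    have hb : ∀ z : ℂ, 0 ≤ z.im → ‖ℓ (moebiusShrink s z)‖ ≤ B := fun z hz =>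
      hB _ ⟨le_im_moebiusShrink hs.le hs1 hz,
        by simpa using norm_moebiusShrink_le hs hs1 hz⟩
    refine (lintegral_div_add_I_le (F := fun z => ℓ (moebiusShrink s z)) hd hb hy).trans ?_
    simp only [M]
    gcongr
    refine (lintegral_enorm_sq_le_of_re hd hb).trans ?_
    rw [moebiusShrink_I hs.le]
    refine add_le_add_left (mul_le_mul_right ?_ _) _
    have h2 := lintegral_lintegral_poissonMeasure_comp
      (fun z hz => differentiableAt_moebiusShrink hs.le hz) hs
      (fun z hz => le_im_moebiusShrink hs.le hs1 hz) hI hm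
    rw [moebiusShrink_I hs.le] at h2
    rw [← h2]
    exact lintegral_mono fun t =>
      hre _ (hs.trans_le (le_im_moebiusShrink hs.le hs1 (by simp)))
  refine ⟨M, hM, fun y hy => ?_⟩
  set s : ℕ → ℝ := fun n => 1 / ((n : ℝ) + 1)
  have hs0 : ∀ n, 0 < s n := fun n => by positivity
  have hs1 : ∀ n, s n ≤ 1 := fun n => by
    simp only [s]
    rw [div_le_one (by positivity)]
    linarith [(Nat.cast_nonneg n : (0 : ℝ) ≤ n)]
  have hlim : ∀ x : ℝ, ‖ℓ (x + y * I) / (x + y * I + I)‖ₑ ^ (2 : ℝ) =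
      liminf (fun n => ‖ℓ (moebiusShrink (s n) (x + y * I)) / (x + y * I + I)‖ₑ ^ (2 : ℝ)) atTop := by
    intro x
    have hx : (x : ℂ) + y * I ∈ {z : ℂ | 0 < z.im} := by simpa using hy
    have h1 : Tendsto (fun n => ℓ (moebiusShrink (s n) (x + y * I))) atTop (𝓝 (ℓ (x + y * I))) :=
      (hℓ.differentiableAt (isOpen_upper.mem_nhds hx)).continuousAt.tendsto.comp
        (tendsto_moebiusShrink _ tendsto_one_div_add_atTop_nhds_zero_nat)
    exact (((ENNReal.continuous_rpow_const.tendsto _).comp (h1.div_const _).enorm).liminf_eq).symm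
  simp_rw [hlim]
  refine (lintegral_liminf_le fun n => ?_).trans ?_
  · refine Measurable.pow_const (Measurable.enorm (Measurable.div ?_ (by fun_prop))) _
    refine Continuous.measurable (hℓ.continuousOn.comp_continuous ?_ fun x => ?_)
    · refine continuous_iff_continuousAt.2 fun x => ?_
      exact ContinuousAt.comp (f := fun t : ℝ => (t : ℂ) + y * I)
        (differentiableAt_moebiusShrink (hs0 n).le (by simpa using hy.le)).continuousAt (by fun_prop)
    · exact (hs0 n).trans_le (le_im_moebiusShrink (hs0 n).le (hs1 n) (by simpa using hy.le))
  · refine liminf_le_of_le ⟨0, by simp⟩ fun b hb' => ?_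
    obtain ⟨n, hn⟩ := hb'.exists
    exact hn.trans (hs _ (hs0 n) (hs1 n) y hy)

/-! ### Rigidity on the real line, reciprocals, and logarithms in the weighted H². -/

/-- A function that is analytic in the upper half-plane together with its complex conjugate is
constant there. -/
lemma exists_const_of_eq_conj {A B : ℂ → ℂ} (hA : DifferentiableOn ℂ A {z | 0 < z.im})
    (hB : DifferentiableOn ℂ B {z | 0 < z.im})
    (h : ∀ z : ℂ, 0 < z.im → A z = (starRingEnd ℂ) (B z)) : ∃ C, ∀ z : ℂ, 0 < z.im → A z = C := by
  have hder : ∀ z ∈ {z : ℂ | 0 < z.im}, deriv A z = 0 := by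
    intro z hz
    have hn := isOpen_upper.mem_nhds hz
    have hA' := (hA.differentiableAt hn).hasDerivAt
    have hB' := (hB.differentiableAt hn).hasDerivAt
    -- Differentiation along real lines in the direction `v`: the left side is linear in `v`, the
    -- right side antilinear. The directions `1` and `i` force `deriv A z = 0`.
    have key : ∀ v : ℂ, deriv A z * v = (starRingEnd ℂ) (deriv B z * v) := by
      intro v
      have hl : HasDerivAt (fun t : ℝ => z + t * v) v 0 := by
        simpa using ((Complex.ofRealCLM.hasDerivAt (x := (0 : ℝ))).mul_const v).const_add z
      have h0 : z + ((0 : ℝ) : ℂ) * v = z := by simp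
      have h1 : HasDerivAt (fun t : ℝ => A (z + t * v)) (deriv A z * v) 0 :=
        HasDerivAt.comp (h₂ := A) (h := fun t : ℝ => z + t * v) (0 : ℝ) (by rw [h0]; exact hA') hl
      have h2 : HasDerivAt (fun t : ℝ => B (z + t * v)) (deriv B z * v) 0 :=
        HasDerivAt.comp (h₂ := B) (h := fun t : ℝ => z + t * v) (0 : ℝ) (by rw [h0]; exact hB') hl
      have h3 : HasDerivAt (fun t : ℝ => (starRingEnd ℂ) (B (z + t * v)))
          ((starRingEnd ℂ) (deriv B z * v)) 0 := h2.star
      refine h1.unique (h3.congr_of_eventuallyEq ?_)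
      have h4 : ∀ᶠ t : ℝ in 𝓝 0, z + (t : ℂ) * v ∈ {z : ℂ | 0 < z.im} :=
        hl.continuousAt.preimage_mem_nhds (by rw [h0]; exact hn)
      filter_upwards [h4] with t ht using h _ ht
    have k1 := key 1
    have k2 := key I
    rw [mul_one, mul_one] at k1
    rw [map_mul, ← k1, Complex.conj_I] at k2
    have k3 : 2 * I * deriv A z = 0 := by linear_combination k2
    simpa using k3
  obtain ⟨C, hC⟩ := isOpen_upper.exists_is_const_of_deriv_eq_zero
    (Side.upper_halfPlane ▸ Side.upper.convex_halfPlane.isPreconnected) hA hder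
  exact ⟨C, fun z hz => hC z hz⟩

/-- Squaring `|x| ≤ exp (|x| / 2)` suffices. With `x = Re ℓ` the right side becomes `|exp ℓ| + |exp
ℓ|⁻¹`. -/
lemma sq_le_exp_add_exp_neg (x : ℝ) : x ^ 2 ≤ Real.exp x + Real.exp (-x) := by
  have h1 := Real.quadratic_le_exp_of_nonneg (x := |x| / 2) (by positivity)
  have h2 : |x| ≤ Real.exp (|x| / 2) := by nlinarith [sq_nonneg (|x| - 2)]
  have h3 : x ^ 2 ≤ Real.exp |x| := by
    have h := pow_le_pow_left₀ (abs_nonneg x) h2 2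
    rwa [sq_abs, ← Real.exp_nat_mul, Nat.cast_ofNat, mul_div_cancel₀ _ two_ne_zero] at h
  rcases abs_cases x with h | h <;> rw [h.1] at h3
  · linarith [Real.exp_pos (-x)]
  · linarith [Real.exp_pos x]

namespace UpperHardy

/-- Two functions of Hardy spaces with conjugate boundary functions are constant. -/
lemma exists_const_of_boundary_eq_conj {q : ℝ} (hq : 1 < q) {F G : ℂ → ℂ} {f g : ℝ → ℂ}
    (hF : UpperHardy q F f) (hG : UpperHardy q G g)
    (h : ∀ᵐ t : ℝ, f t = (starRingEnd ℂ) (g t)) : ∃ C, ∀ z : ℂ, 0 < z.im → F z = C := by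
  refine exists_const_of_eq_conj hF.differentiableOn hG.differentiableOn fun z hz => ?_
  rw [hF.eq_integral hq hz, hG.eq_integral hq hz, ← integral_conj]
  exact integral_congr_ae ((poissonMeasure_absolutelyContinuous z).ae_le h)

/-- The extension is constant, and a nonzero constant has infinite `L^q` norm on a line. -/
lemma eq_zero_of_boundary_eq_conj {q : ℝ} (hq : 1 < q) {F G : ℂ → ℂ} {f g : ℝ → ℂ}
    (hF : UpperHardy q F f) (hG : UpperHardy q G g)
    (h : ∀ᵐ t : ℝ, f t = (starRingEnd ℂ) (g t)) : ∀ᵐ t : ℝ, f t = 0 := by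
  obtain ⟨C, hC⟩ := hF.exists_const_of_boundary_eq_conj hq hG h
  obtain ⟨M, hM, hb⟩ := hF.means
  have h1 := hb 1 one_pos
  have h2 : ∀ x : ℝ, F (x + (1 : ℝ) * I) = C := fun x => hC _ (by simp)
  simp_rw [h2] at h1
  have hC0 : C = 0 := by
    by_contra hne
    refine hM (top_le_iff.1 (le_trans (le_of_eq ?_) h1))
    rw [lintegral_const, Real.volume_univ, ENNReal.mul_top]
    exact (ENNReal.rpow_pos (by simpa using hne) enorm_ne_top).ne'
  filter_upwards [hF.boundary] with x hx
  refine tendsto_nhds_unique hx ?_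
  rw [← hC0]
  refine tendsto_const_nhds.congr fun n => (hC _ ?_).symm
  simp only [Complex.add_im, Complex.ofReal_im, Complex.im_ofReal_mul, Complex.I_im, mul_one, zero_add]
  positivity

/-- Products `(z + i)² F G` of functions of Hardy spaces with conjugate exponents, taken over the
upper half-plane and over the reflected lower one, are constant if they agree on the real line. -/
lemma exists_const_of_mul_eq_conj {q r : ℝ} (hqr : q.HolderConjugate r) {F G F' G' : ℂ → ℂ}
    {f g f' g' : ℝ → ℂ} (hF : UpperHardy q F f) (hG : UpperHardy r G g) (hF' : UpperHardy q F' f')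
    (hG' : UpperHardy r G' g') (h : ∀ᵐ t : ℝ, ((t : ℂ) + I) ^ 2 * (f t * g t) =
      (starRingEnd ℂ) (((t : ℂ) + I) ^ 2 * (f' t * g' t))) :
    ∃ C, ∀ᵐ t : ℝ, ((t : ℂ) + I) ^ 2 * (f t * g t) = C := by
  have hd : ∀ {F G : ℂ → ℂ}, DifferentiableOn ℂ F {z | 0 < z.im} →
      DifferentiableOn ℂ G {z | 0 < z.im} →
      DifferentiableOn ℂ (fun z => (z + I) ^ 2 * (F z * G z)) {z | 0 < z.im} := by
    intro F G h1 h2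
    exact DifferentiableOn.mul (by fun_prop) (h1.mul h2)
  obtain ⟨C, hC⟩ := exists_const_of_eq_conj (hd hF.differentiableOn hG.differentiableOn)
    (hd hF'.differentiableOn hG'.differentiableOn) fun z hz => by
      rw [hF.mul_eq_integral hqr hG hz, hF'.mul_eq_integral hqr hG' hz, ← integral_conj]
      refine integral_congr_ae ?_
      filter_upwards [h] with t ht
      rw [mul_assoc, mul_assoc, ht, map_mul _ (halfPlanePoisson z t : ℂ), Complex.conj_ofReal]
  refine ⟨C, ?_⟩
  filter_upwards [hF.boundary, hG.boundary] with x hx hx'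
  have h1 : Tendsto (fun n : ℕ => (((x : ℂ) + (1 / ((n : ℝ) + 1) : ℝ) * I) + I) ^ 2) atTop
      (𝓝 (((x : ℂ) + I) ^ 2)) := ((tendsto_vertical (x : ℂ)).add_const I).pow 2
  refine tendsto_nhds_unique (h1.mul (hx.mul hx')) ?_
  refine tendsto_const_nhds.congr fun n => (hC _ ?_).symm
  simp only [Complex.add_im, Complex.ofReal_im, Complex.im_ofReal_mul, Complex.I_im, mul_one, zero_add]
  positivity

/-- Extensions of reciprocal boundary functions are reciprocal. -/
lemma mul_eq_one {q r : ℝ} (hqr : q.HolderConjugate r) {F G : ℂ → ℂ} {f : ℝ → ℂ}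
    (hF : UpperHardy q F fun t => f t / (t + I)) (hG : UpperHardy r G fun t => (f t)⁻¹ / (t + I))
    (hf : ∀ᵐ t : ℝ, f t ≠ 0) {w : ℂ} (hw : 0 < w.im) :
    ((w + I) * F w) * ((w + I) * G w) = 1 := by
  have h1 := hF.mul_eq_integral hqr hG hw
  have h2 : ∫ t : ℝ, (halfPlanePoisson w t * ((t : ℂ) + I) ^ 2) *
      (f t / (t + I) * ((f t)⁻¹ / (t + I))) = ∫ t : ℝ, (halfPlanePoisson w t : ℂ) := by
    refine integral_congr_ae ?_
    filter_upwards [hf] with t ht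
    have := add_I_ne_zero (z := t) (by simp)
    field_simp
  rw [h2, integral_complex_ofReal, integral_halfPlanePoisson hw, Complex.ofReal_one] at h1
  linear_combination h1

/-- Pairing `F` with `1 / (z + i)` in the product formula represents `(w + i) F w` as the Poisson
integral of `f`. -/
lemma enorm_mul_le_lintegral {q r : ℝ} (hqr : q.HolderConjugate r) {F : ℂ → ℂ} {f : ℝ → ℂ}
    (hF : UpperHardy q F fun t => f t / (t + I)) {w : ℂ} (hw : 0 < w.im) :
    ‖(w + I) * F w‖ₑ ≤ ∫⁻ t, ‖f t‖ₑ ∂poissonMeasure w := by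
  have h1 := hF.mul_eq_integral hqr (upperHardy_const_div hqr.symm.lt 1) hw
  have h2 : ∫ t : ℝ, (halfPlanePoisson w t * ((t : ℂ) + I) ^ 2) *
      (f t / (t + I) * (1 / (t + I))) = ∫ t, f t ∂poissonMeasure w := by
    rw [integral_poissonMeasure hw]
    refine integral_congr_ae (Eventually.of_forall fun t => ?_)
    have := add_I_ne_zero (z := t) (by simp)
    field_simp
  have h3 : (w + I) * F w = (w + I) ^ 2 * (F w * (1 / (w + I))) := by
    have := add_I_ne_zero hw.le
    field_simp
  rw [h3, h1, h2]
  exact enorm_integral_le_lintegral_enorm _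

lemma lintegral_poissonMeasure_I_ne_top {q r : ℝ} (hqr : q.HolderConjugate r) {F : ℂ → ℂ}
    {f : ℝ → ℂ} (hF : UpperHardy q F fun t => f t / (t + I)) :
    ∫⁻ t, ‖f t‖ₑ ∂poissonMeasure I ≠ ⊤ := by
  have h1 := (hF.integrable_mul hqr (upperHardy_const_div hqr.symm.lt 1)).2
  have h2 : ∀ t : ℝ, ENNReal.ofReal (halfPlanePoisson I t) * ‖f t‖ₑ =
      ENNReal.ofReal (1 / Real.pi) * ‖f t / (t + I) * (1 / ((t : ℂ) + I))‖ₑ := by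
    intro t
    have hpi := Real.pi_pos
    rw [← ofReal_norm, ← ofReal_norm, ← ENNReal.ofReal_mul (halfPlanePoisson_pos (by simp) t).le,
      ← ENNReal.ofReal_mul (by positivity), halfPlanePoisson_I]
    congr 1
    have e : 1 + t ^ 2 = ‖(t : ℂ) + I‖ ^ 2 := by
      rw [← Complex.normSq_eq_norm_sq]
      simp [Complex.normSq_apply]
      ring
    rw [e, norm_mul, norm_div, norm_div, norm_one]
    have := zero_lt_one.trans_le (one_le_norm_add_I (z := t) (by simp))
    field_simp
  rw [lintegral_poissonMeasure]
  simp_rw [h2]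
  rw [lintegral_const_mul' _ _ ENNReal.ofReal_ne_top]
  exact ENNReal.mul_ne_top ENNReal.ofReal_ne_top h1.ne

lemma aestronglyMeasurable_of_div {q : ℝ} {F : ℂ → ℂ} {f : ℝ → ℂ}
    (hF : UpperHardy q F fun t => f t / (t + I)) : AEStronglyMeasurable f volume := by
  have h1 : Continuous fun t : ℝ => (t : ℂ) + I := by fun_prop
  refine (hF.aestronglyMeasurable.mul h1.aestronglyMeasurable).congr
    (Eventually.of_forall fun t => ?_)
  exact div_mul_cancel₀ _ (add_I_ne_zero (by simp))

/-- The logarithm of a function of a weighted Hardy space whose reciprocal belongs to the space with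
the conjugate exponent is a function of the weighted `H²`. -/
theorem log {q r : ℝ} (hqr : q.HolderConjugate r) {ℓ G : ℂ → ℂ} {f u : ℝ → ℂ}
    (hℓ : DifferentiableOn ℂ ℓ {z | 0 < z.im})
    (hF : UpperHardy q (fun z => Complex.exp (ℓ z) / (z + I)) fun t => f t / (t + I))
    (hG : UpperHardy r G fun t => (f t)⁻¹ / (t + I)) (hf : ∀ᵐ t : ℝ, f t ≠ 0)
    (hu : ∀ᵐ x : ℝ, NontangentialLimit Side.upper ℓ x (u x)) :
    UpperHardy 2 (fun z => ℓ z / (z + I)) fun t => u t / (t + I) where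
  differentiableOn := hℓ.div (by fun_prop) fun z hz => add_I_ne_zero (le_of_lt hz)
  means := by
    -- The Poisson integral of this `m` dominates `|exp ℓ| + |exp (-ℓ)|`, since the weighted
    -- extension of `f⁻¹` is the reciprocal of that of `f`.
    refine exists_means_of_re_sq_le hℓ (m := fun t => ‖f t‖ₑ + ‖(f t)⁻¹‖ₑ) ?_ ?_ fun z hz => ?_
    · exact hF.aestronglyMeasurable_of_div.enorm.add hG.aestronglyMeasurable_of_div.enorm
    · rw [lintegral_add_left' (hF.aestronglyMeasurable_of_div.enorm.mono_ac
        (poissonMeasure_absolutelyContinuous I))]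
      exact ENNReal.add_ne_top.2 ⟨hF.lintegral_poissonMeasure_I_ne_top hqr,
        hG.lintegral_poissonMeasure_I_ne_top hqr.symm⟩
    · rw [lintegral_add_left' (hF.aestronglyMeasurable_of_div.enorm.mono_ac
        (poissonMeasure_absolutelyContinuous z))]
      refine le_trans ?_ (add_le_add (hF.enorm_mul_le_lintegral hqr hz)
        (hG.enorm_mul_le_lintegral hqr.symm hz))
      have h1 := hF.mul_eq_one hqr hG hf hz
      rw [mul_div_cancel₀ _ (add_I_ne_zero hz.le)] at h1 ⊢
      have h2 : (z + I) * G z = Complex.exp (-ℓ z) := by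
        rw [Complex.exp_neg]
        exact eq_inv_of_mul_eq_one_right h1
      rw [h2, ← ofReal_norm, ← ofReal_norm, Complex.norm_exp, Complex.norm_exp,
        ← ENNReal.ofReal_add (Real.exp_nonneg _) (Real.exp_nonneg _), Complex.neg_re]
      refine ENNReal.ofReal_le_ofReal ?_
      exact sq_le_exp_add_exp_neg _
  boundary := by
    filter_upwards [hu] with x hx
    have h1 : Tendsto (fun n : ℕ => ((x : ℂ) + (1 / ((n : ℝ) + 1) : ℝ) * I) + I) atTop
      (𝓝 ((x : ℂ) + I)) := (tendsto_vertical (x : ℂ)).add_const I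
    exact hx.tendsto_vertical.div h1 (add_I_ne_zero (by simp))

/-- Membership in `H²` by comparison. -/
lemma of_norm_sq_le {F F₁ F₂ : ℂ → ℂ} {f f₁ f₂ : ℝ → ℂ} (h₁ : UpperHardy 2 F₁ f₁)
    (h₂ : UpperHardy 2 F₂ f₂) (hF : DifferentiableOn ℂ F {z | 0 < z.im})
    (hf : ∀ᵐ x : ℝ, Tendsto (fun n : ℕ => F (x + (1 / ((n : ℝ) + 1) : ℝ) * I)) atTop (𝓝 (f x)))
    {K : ℝ} (hK : 0 ≤ K) (h : ∀ z : ℂ, 0 < z.im → ‖F z‖ ^ 2 ≤ K * (‖F₁ z‖ ^ 2 + ‖F₂ z‖ ^ 2)) :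
    UpperHardy 2 F f where
  differentiableOn := hF
  boundary := hf
  means := by
    obtain ⟨M₁, hM₁, hb₁⟩ := h₁.means
    obtain ⟨M₂, hM₂, hb₂⟩ := h₂.means
    refine ⟨ENNReal.ofReal K * (M₁ + M₂),
      ENNReal.mul_ne_top ENNReal.ofReal_ne_top (ENNReal.add_ne_top.2 ⟨hM₁, hM₂⟩), fun y hy => ?_⟩
    have e1 : ∀ z : ℂ, ‖z‖ₑ ^ (2 : ℝ) = ENNReal.ofReal (‖z‖ ^ 2) := by
      intro z
      rw [← ofReal_norm, ENNReal.ofReal_rpow_of_nonneg (norm_nonneg _) zero_le_two, Real.rpow_two]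
    have h3 : ∀ x : ℝ, ‖F (x + y * I)‖ₑ ^ (2 : ℝ) ≤ ENNReal.ofReal K *
        (‖F₁ (x + y * I)‖ₑ ^ (2 : ℝ) + ‖F₂ (x + y * I)‖ₑ ^ (2 : ℝ)) := by
      intro x
      rw [e1, e1, e1, ← ENNReal.ofReal_add (by positivity) (by positivity), ← ENNReal.ofReal_mul hK]
      exact ENNReal.ofReal_le_ofReal (h _ (by simpa using hy))
    refine (lintegral_mono h3).trans ?_
    rw [lintegral_const_mul' _ _ ENNReal.ofReal_ne_top, lintegral_add_left
      ((h₁.differentiableOn.continuous_horizontal hy).measurable.enorm.pow_const _)]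
    gcongr
    · exact hb₁ y hy
    · exact hb₂ y hy

lemma add_const_div {ℓ : ℂ → ℂ} {u : ℝ → ℂ}
    (h : UpperHardy 2 (fun z => ℓ z / (z + I)) fun t => u t / (t + I)) (c : ℂ) :
    UpperHardy 2 (fun z => (ℓ z + c) / (z + I)) fun t => (u t + c) / (t + I) := by
  have h2 := upperHardy_const_div one_lt_two c
  refine h.of_norm_sq_le h2 (K := 2) ?_ ?_ zero_le_two fun z _ => ?_
  · simp_rw [add_div]
    exact h.differentiableOn.add h2.differentiableOn
  · filter_upwards [h.boundary, h2.boundary] with x hx hx'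
    simp_rw [add_div]
    exact hx.add hx'
  · rw [add_div]
    have := norm_add_le (ℓ z / (z + I)) (c / (z + I))
    have h3 := pow_le_pow_left₀ (norm_nonneg _) this 2
    nlinarith [sq_nonneg (‖ℓ z / (z + I)‖ - ‖c / (z + I)‖)]

/-- Removal of the pole at `i`. -/
lemma dslope {ℓ : ℂ → ℂ} {u : ℝ → ℂ} (hℓ : DifferentiableOn ℂ ℓ {z | 0 < z.im})
    (hu : ∀ᵐ x : ℝ, NontangentialLimit Side.upper ℓ x (u x))
    (h : UpperHardy 2 (fun z => ℓ z / (z + I)) fun t => u t / (t + I)) :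
    UpperHardy 2 (dslope ℓ I) (fun t => (u t - ℓ I) / (t - I)) ∧
      ∀ᵐ x : ℝ, NontangentialLimit Side.upper (_root_.dslope ℓ I) x ((u x - ℓ I) / (x - I)) := by
  have hIm : I ∈ {z : ℂ | 0 < z.im} := by simp
  have hd : DifferentiableOn ℂ (_root_.dslope ℓ I) {z | 0 < z.im} :=
    (Complex.differentiableOn_dslope (isOpen_upper.mem_nhds hIm)).2 hℓ
  have hnt : ∀ᵐ x : ℝ,
      NontangentialLimit Side.upper (_root_.dslope ℓ I) x ((u x - ℓ I) / (x - I)) := by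
    filter_upwards [hu] with x hx a ha
    have hxI : (x : ℂ) - I ≠ 0 := ofReal_sub_ne_zero (by simp) x
    have h1 : Tendsto (fun z : ℂ => z - I) (𝓝[Side.upper.cone a x] (x : ℂ)) (𝓝 ((x : ℂ) - I)) :=
      (Continuous.tendsto (by fun_prop) _).mono_left nhdsWithin_le_nhds
    refine (((hx a ha).sub_const (ℓ I)).div h1 hxI).congr' ?_
    filter_upwards [h1.eventually_ne hxI] with z hz
    rw [dslope_of_ne _ (sub_ne_zero.1 hz), slope_def_field, Pi.div_apply]
  refine ⟨?_, hnt⟩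
  -- Within distance `1/2` of `i` the quotient is bounded by compactness and `|z + i| ≤ 5/2`.
  -- Farther away `|z + i| ≤ |z - i| + 2 ≤ 5 |z - i|`, so the weight `1 / (z - i)` is comparable to
  -- `1 / (z + i)`. The constant `K` adds the bounds of the two cases.
  have hcpt : IsCompact (Metric.closedBall I (1 / 2)) := isCompact_closedBall _ _
  obtain ⟨B, hB⟩ := hcpt.exists_bound_of_continuousOn (hd.continuousOn.mono fun z hz => by
    rw [mem_closedBall_iff_norm] at hz
    have h1 := (Complex.abs_im_le_norm (z - I)).trans hz
    have h2 := neg_abs_le (z - I).im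
    simp only [Complex.sub_im, Complex.I_im] at h1 h2
    show 0 < z.im
    linarith)
  refine h.of_norm_sq_le (upperHardy_const_div one_lt_two 1)
    (K := 50 * (1 + ‖ℓ I‖ ^ 2) + (5 / 2 * B) ^ 2) hd
    (hnt.mono fun x hx => hx.tendsto_vertical) (by positivity) fun z hz => ?_
  have hz1 := zero_lt_one.trans_le (one_le_norm_add_I hz.le)
  rw [norm_div, norm_div, div_pow, div_pow, ← add_div, ← mul_div_assoc, le_div_iff₀ (by positivity),
    norm_one, one_pow, ← mul_pow]
  have htri : ‖z + I‖ ≤ ‖z - I‖ + 2 := by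
    calc ‖z + I‖ = ‖(z - I) + 2 * I‖ := by ring_nf
      _ ≤ ‖z - I‖ + ‖2 * I‖ := norm_add_le _ _
      _ = _ := by simp
  have hL := norm_nonneg (ℓ z)
  have hc := norm_nonneg (ℓ I)
  have hD := norm_nonneg (_root_.dslope ℓ I z)
  rcases le_total ‖z - I‖ (1 / 2) with hzI | hzI
  · have h1 := hB z (mem_closedBall_iff_norm.2 hzI)
    have h2 : ‖_root_.dslope ℓ I z‖ * ‖z + I‖ ≤ 5 / 2 * B := by
      have : ‖z + I‖ ≤ 5 / 2 := by linarith
      nlinarith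
    have h3 := pow_le_pow_left₀ (by positivity) h2 2
    nlinarith [mul_nonneg (sq_nonneg (5 / 2 * B)) (sq_nonneg ‖ℓ z‖), sq_nonneg ‖ℓ z‖,
      mul_nonneg (sq_nonneg ‖ℓ I‖) (sq_nonneg ‖ℓ z‖), sq_nonneg ‖ℓ I‖]
  · have hne : z - I ≠ 0 := norm_pos_iff.1 (by linarith)
    have h1 : ‖_root_.dslope ℓ I z‖ * ‖z - I‖ = ‖ℓ z - ℓ I‖ := by
      rw [dslope_of_ne _ (sub_ne_zero.1 hne), slope_def_field, ← norm_mul, div_mul_cancel₀ _ hne]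
    have h2 : ‖_root_.dslope ℓ I z‖ * ‖z + I‖ ≤ 5 * (‖ℓ z‖ + ‖ℓ I‖) := by
      have h4 := norm_sub_le (ℓ z) (ℓ I)
      have h5 : ‖z + I‖ ≤ 5 * ‖z - I‖ := by linarith
      nlinarith
    have h3 := pow_le_pow_left₀ (by positivity) h2 2
    nlinarith [mul_nonneg (sq_nonneg (5 / 2 * B)) (sq_nonneg ‖ℓ z‖), sq_nonneg ‖ℓ z‖,
      mul_nonneg (sq_nonneg ‖ℓ I‖) (sq_nonneg ‖ℓ z‖), sq_nonneg ‖ℓ I‖, sq_nonneg (‖ℓ z‖ - ‖ℓ I‖),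
      sq_nonneg (5 / 2 * B)]

end UpperHardy

/-! ### Hardy spaces of both half-planes, the projections, and logarithms of the factors. -/

lemma Side.lam_ofReal_ne_zero (σ : Side) (x : ℝ) : σ.lam x ≠ 0 := by
  intro h
  have := congrArg Complex.im h
  cases σ <;> simp [Side.lam, Side.sign] at this

lemma Side.conj_lam (σ : Side) (z : ℂ) :
    (starRingEnd ℂ) (σ.lam z) = σ.opp.lam ((starRingEnd ℂ) z) := by
  simp [Side.lam, Side.sign_opp]

lemma Side.conj_lam_ofReal (σ : Side) (x : ℝ) : (starRingEnd ℂ) (σ.lam x) = σ.opp.lam x := by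
  rw [Side.conj_lam, Complex.conj_ofReal]

lemma Side.upper_lam (z : ℂ) : Side.upper.lam z = z + I := by simp [Side.lam, Side.sign]

lemma IsHardyExtension.congr_ae {σ : Side} {p : ENNReal} {F : ℂ → ℂ} {f g : ℝ → ℂ}
    (h : IsHardyExtension σ p F f) (hfg : f =ᵐ[volume] g) : IsHardyExtension σ p F g where
  analytic := h.analytic
  bounded_means := h.bounded_means
  boundary := by
    filter_upwards [h.boundary, hfg] with x hx hx'
    rwa [← hx']

lemma IsHardyExtension.congr {σ : Side} {p : ENNReal} {F G : ℂ → ℂ} {f : ℝ → ℂ}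
    (h : IsHardyExtension σ p F f) (hFG : ∀ z ∈ σ.halfPlane, F z = G z) :
    IsHardyExtension σ p G f where
  analytic := h.analytic.congr fun z hz => (hFG z hz).symm
  bounded_means := by
    obtain ⟨M, hM⟩ := h.bounded_means
    refine ⟨M, fun y hy => (le_of_eq ?_).trans (hM y hy)⟩
    refine eLpNorm_congr_ae (Eventually.of_forall fun x => (hFG _ ?_).symm)
    simp only [Side.halfPlane, Set.mem_ofPred_eq, Complex.add_im, Complex.ofReal_im,
      Complex.im_ofReal_mul, Complex.I_im, mul_one, zero_add]
    rw [← mul_assoc, σ.sign_mul_sign, one_mul]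
    exact hy
  boundary := h.boundary.mono fun x hx => hx.congr hFG

lemma MemHardy.congr_ae {σ : Side} {p : ENNReal} {f g : ℝ → ℂ} (h : MemHardy σ p f)
    (hfg : f =ᵐ[volume] g) : MemHardy σ p g :=
  ⟨h.1.ae_eq hfg, h.2.imp fun _ hF => hF.congr_ae hfg⟩

lemma IsHardyExtension.continuous_horizontal {σ : Side} {p : ENNReal} {F : ℂ → ℂ} {f : ℝ → ℂ}
    (h : IsHardyExtension σ p F f) {y : ℝ} (hy : 0 < y) :
    Continuous fun x : ℝ => F ((x : ℂ) + ((σ.sign * y : ℝ) : ℂ) * I) := by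
  refine h.analytic.continuousOn.comp_continuous (by fun_prop) fun x => ?_
  simp only [Side.halfPlane, Set.mem_ofPred_eq, Complex.add_im, Complex.ofReal_im,
    Complex.im_ofReal_mul, Complex.I_im, mul_one, zero_add]
  rw [← mul_assoc, σ.sign_mul_sign, one_mul]
  exact hy

lemma MemHardy.sub {σ : Side} {p : ENNReal} (hp : 1 ≤ p) {f g : ℝ → ℂ} (hf : MemHardy σ p f)
    (hg : MemHardy σ p g) : MemHardy σ p fun x => f x - g x := by
  obtain ⟨hf, F, hF⟩ := hf
  obtain ⟨hg, G, hG⟩ := hg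
  obtain ⟨M, hM⟩ := hF.bounded_means
  obtain ⟨N, hN⟩ := hG.bounded_means
  refine ⟨hf.sub hg, fun z => F z - G z, hF.analytic.sub hG.analytic, ⟨M + N, fun y hy => ?_⟩, ?_⟩
  · refine (eLpNorm_sub_le (hF.continuous_horizontal hy).aestronglyMeasurable
      (hG.continuous_horizontal hy).aestronglyMeasurable hp).trans ?_
    rw [ENNReal.coe_add]
    exact add_le_add (hM y hy) (hN y hy)
  · filter_upwards [hF.boundary, hG.boundary] with x hx hx' using hx.sub hx'

lemma UpperHardy.memHardy {F : ℂ → ℂ} {f : ℝ → ℂ} (h : UpperHardy 2 F f)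
    (hb : ∀ᵐ x : ℝ, NontangentialLimit Side.upper F x (f x)) : MemHardy Side.upper 2 f := by
  have h1 := h.memLp two_pos
  have h2 := h.isHardyExtension two_pos hb
  rw [ENNReal.ofReal_ofNat] at h1 h2
  exact ⟨h1, F, h2⟩

/-- The Hardy spaces `H²` of the two half-planes intersect trivially. -/
lemma MemHardy.ae_eq_zero {f : ℝ → ℂ} (h1 : MemHardy Side.upper 2 f)
    (h2 : MemHardy Side.lower 2 f) : ∀ᵐ x : ℝ, f x = 0 := by
  obtain ⟨-, F, hF⟩ := h1
  obtain ⟨-, G, hG⟩ := h2.conj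
  rw [← ENNReal.ofReal_ofNat] at hF hG
  exact (hF.upperHardy two_pos).eq_zero_of_boundary_eq_conj one_lt_two (hG.upperHardy two_pos)
    (Eventually.of_forall fun t => by simp)

/-- Two decompositions differ by a function lying in both spaces `H²`, which vanishes almost
everywhere. Any explicit decomposition therefore computes the chosen projection. -/
lemma rieszProj_ae_eq {σ : Side} {f u : ℝ → ℂ} (hu : MemHardy σ 2 u)
    (hv : MemHardy σ.opp 2 fun x => f x - u x) : rieszProj σ 2 f =ᵐ[volume] u := by
  have hex : ∃ u : ℝ → ℂ, MemHardy σ 2 u ∧ MemHardy σ.opp 2 (fun x => f x - u x) := ⟨u, hu, hv⟩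
  have hspec := hex.choose_spec
  have hdef : rieszProj σ 2 f = hex.choose := dif_pos hex
  rw [hdef]
  generalize hex.choose = w at hspec
  have h1 := hspec.1.sub one_le_two hu
  have h2 : MemHardy σ.opp 2 fun x => w x - u x :=
    (hv.sub one_le_two hspec.2).congr_ae (Eventually.of_forall fun x => by ring)
  have h3 : ∀ᵐ x : ℝ, w x - u x = 0 := by
    cases σ
    · exact h1.ae_eq_zero h2
    · exact h2.ae_eq_zero h1
  filter_upwards [h3] with x hx using sub_eq_zero.1 hx

lemma MemCalHardy.conj {σ : Side} {p : ENNReal} {f : ℝ → ℂ} (h : MemCalHardy σ p f) :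
    MemCalHardy σ.opp p fun x => (starRingEnd ℂ) (f x) := by
  have h1 := MemHardy.conj h
  simp only [map_div₀, Side.conj_lam_ofReal] at h1
  exact h1

lemma IsLogOfFactor.conj {σ : Side} {p : ENNReal} {f u : ℝ → ℂ} (h : IsLogOfFactor σ p f u) :
    IsLogOfFactor σ.opp p (fun x => (starRingEnd ℂ) (f x)) fun x => (starRingEnd ℂ) (u x) := by
  obtain ⟨ℓ, hℓ, hF, hu⟩ := h
  refine ⟨fun z => (starRingEnd ℂ) (ℓ ((starRingEnd ℂ) z)), fun z hz => ?_, ?_,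
    hu.mono fun x hx => hx.conj⟩
  · refine DifferentiableAt.differentiableWithinAt ?_
    have hz' : (starRingEnd ℂ) z ∈ σ.halfPlane := by
      simp only [Side.halfPlane, Set.mem_ofPred_eq, Side.sign_opp] at hz ⊢
      simpa using hz
    have := (hℓ.differentiableAt (σ.isOpen_halfPlane.mem_nhds hz')).conj_conj
    simpa [Function.comp_def] using this
  · have h1 := hF.conj
    simp only [map_div₀, Side.conj_lam, Complex.conj_conj, Complex.conj_ofReal,
      ← Complex.exp_conj] at h1
    exact h1

lemma MemCalHardy.exists_upperHardy {q : ℝ} (hq : 0 < q) {f : ℝ → ℂ}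
    (h : MemCalHardy Side.upper (ENNReal.ofReal q) f) :
    ∃ F, UpperHardy q F fun t => f t / (t + I) := by
  obtain ⟨-, F, hF⟩ := h
  simp only [Side.upper_lam] at hF
  exact ⟨F, hF.upperHardy hq⟩

/-- Boundary functions of logarithms are logarithms of boundary functions. -/
lemma IsLogOfFactor.exp_ae_eq {σ : Side} {p : ENNReal} {f u : ℝ → ℂ} (h : IsLogOfFactor σ p f u) :
    ∀ᵐ x : ℝ, Complex.exp (u x) = f x := by
  obtain ⟨ℓ, -, hF, hu⟩ := h
  filter_upwards [hF.boundary, hu] with x hx hx'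
  have hlam : NontangentialLimit σ σ.lam x (σ.lam x) :=
    NontangentialLimit.of_continuousAt (by unfold Side.lam; fun_prop)
  have h1 := (hx'.comp Complex.continuous_exp.continuousAt).div hlam (σ.lam_ofReal_ne_zero x)
  exact (div_left_inj' (σ.lam_ofReal_ne_zero x)).1 (h1.unique hx)

/-- The extension of `f` has no zeros, being the reciprocal of the extension of `f⁻¹`, so it has an
analytic logarithm. Boundary limits of that logarithm exist wherever those of the extension exist
and are nonzero, hence almost everywhere. -/
lemma exists_isLogOfFactor_upper {q r : ℝ} (hqr : q.HolderConjugate r) {f : ℝ → ℂ}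
    (hf : MemCalHardy Side.upper (ENNReal.ofReal q) f)
    (hfi : MemCalHardy Side.upper (ENNReal.ofReal r) fun x => (f x)⁻¹)
    (h0 : ∀ᵐ x : ℝ, f x ≠ 0) : ∃ u, IsLogOfFactor Side.upper (ENNReal.ofReal q) f u := by
  obtain ⟨G, hG⟩ := hfi.exists_upperHardy hqr.symm.pos
  obtain ⟨-, F, hF⟩ := hf
  have hFU : UpperHardy q F fun t => f t / (t + I) := by
    have := hF.upperHardy hqr.pos
    simpa only [Side.upper_lam] using this
  have hne : ∀ z ∈ Side.upper.halfPlane, (z + I) * F z ≠ 0 := by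
    intro z hz
    rw [Side.upper_halfPlane] at hz
    exact left_ne_zero_of_mul_eq_one (hFU.mul_eq_one hqr hG h0 hz)
  obtain ⟨ℓ, hℓ, he⟩ := Side.upper.exists_log (G := fun z => (z + I) * F z)
    (DifferentiableOn.mul (a := fun z => z + I) (by fun_prop) hF.analytic) hne
  have hext : IsHardyExtension Side.upper (ENNReal.ofReal q)
      (fun z => Complex.exp (ℓ z) / Side.upper.lam z) fun x => f x / Side.upper.lam x := by
    refine hF.congr fun z hz => ?_
    rw [he z hz, Side.upper_lam, mul_div_cancel_left₀]
    rw [Side.upper_halfPlane] at hz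
    exact add_I_ne_zero (le_of_lt hz)
  have hlim : ∀ᵐ x : ℝ, ∃ u, NontangentialLimit Side.upper ℓ x u := by
    filter_upwards [hF.boundary, h0] with x hx hx0
    refine exists_nontangentialLimit_of_exp hℓ.continuousOn hx0 ?_
    have hlam : NontangentialLimit Side.upper Side.upper.lam x (Side.upper.lam x) :=
      NontangentialLimit.of_continuousAt (by unfold Side.lam; fun_prop)
    have h1 := hlam.mul hx
    rw [mul_div_cancel₀ _ (Side.lam_ofReal_ne_zero _ x)] at h1
    refine h1.congr fun z hz => ?_
    rw [he z hz, Side.upper_lam]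
  choose! u hu using fun (x : ℝ) (h : ∃ u, NontangentialLimit Side.upper ℓ x u) => h
  exact ⟨u, ℓ, hℓ, hext, hlim.mono hu⟩

lemma exists_isLogOfFactor {q r : ℝ} (hqr : q.HolderConjugate r) {σ : Side} {f : ℝ → ℂ}
    (hf : MemCalHardy σ (ENNReal.ofReal q) f)
    (hfi : MemCalHardy σ (ENNReal.ofReal r) fun x => (f x)⁻¹)
    (h0 : ∀ᵐ x : ℝ, f x ≠ 0) : ∃ u, IsLogOfFactor σ (ENNReal.ofReal q) f u := by
  cases σ
  · exact exists_isLogOfFactor_upper hqr hf hfi h0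
  · have hfi' := hfi.conj
    simp only [map_inv₀] at hfi'
    obtain ⟨u, hu⟩ := exists_isLogOfFactor_upper hqr hf.conj hfi' (h0.mono fun x hx => by simpa using hx)
    have h1 := hu.conj
    simp only [Complex.conj_conj] at h1
    exact ⟨_, h1⟩

/-- The logarithm of a factor in the upper half-plane belongs to `H²`, with weight. -/
lemma IsLogOfFactor.exists_upperHardy {q r : ℝ} (hqr : q.HolderConjugate r) {f u : ℝ → ℂ}
    (h : IsLogOfFactor Side.upper (ENNReal.ofReal q) f u)
    (hfi : MemCalHardy Side.upper (ENNReal.ofReal r) fun x => (f x)⁻¹)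
    (h0 : ∀ᵐ x : ℝ, f x ≠ 0) :
    ∃ ℓ : ℂ → ℂ, DifferentiableOn ℂ ℓ {z | 0 < z.im} ∧
      UpperHardy 2 (fun z => ℓ z / (z + I)) (fun t => u t / (t + I)) ∧
      ∀ᵐ x : ℝ, NontangentialLimit Side.upper ℓ x (u x) := by
  obtain ⟨ℓ, hℓ, hF, hu⟩ := h
  rw [Side.upper_halfPlane] at hℓ
  obtain ⟨G, hG⟩ := hfi.exists_upperHardy hqr.symm.pos
  have hFU := hF.upperHardy hqr.pos
  simp only [Side.upper_lam] at hFU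
  exact ⟨ℓ, hℓ, UpperHardy.log hqr hℓ hFU hG h0 hu, hu⟩

/-! ### Uniqueness of the factorization, and the formula for the factors. -/

/-- Canonical factorizations are unique up to a constant factor. -/
lemma IsCanonicalPFactorization.exists_const {p : ℝ} (hp : 1 < p) {g gm gp hm hpl : ℝ → ℂ}
    (h : IsCanonicalPFactorization p g gm gp) (h' : IsCanonicalPFactorization p g hm hpl) :
    ∃ C : ℂ, C ≠ 0 ∧ (∀ᵐ x : ℝ, gp x = C * hpl x) ∧ ∀ᵐ x : ℝ, gm x = C⁻¹ * hm x := by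
  have hqr := (Real.HolderConjugate.conjExponent hp)
  obtain ⟨F, hF⟩ := h.plus_mem.exists_upperHardy hqr.symm.pos
  obtain ⟨G, hG⟩ := h'.plus_inv_mem.exists_upperHardy hqr.pos
  -- After reflection the exponents match those above: the conjugate exponent for `gm⁻¹` as for
  -- `gp`, and `p` for `hm` as for `hpl⁻¹`.
  obtain ⟨F', hF'⟩ := h.minus_inv_mem.conj.exists_upperHardy hqr.symm.pos
  obtain ⟨G', hG'⟩ := h'.minus_mem.conj.exists_upperHardy hqr.pos
  have hmul : ∀ (t : ℝ) (a b : ℂ), ((t : ℂ) + I) ^ 2 * (a / (t + I) * (b / (t + I))) = a * b := by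
    intro t a b
    have := add_I_ne_zero (z := t) (by simp)
    field_simp
  have hquot : ∀ᵐ t : ℝ, gp t * (hpl t)⁻¹ = (gm t)⁻¹ * hm t := by
    filter_upwards [h.eq_mul, h'.eq_mul, h.minus_ne_zero, h'.plus_ne_zero] with t h1 h2 h3 h4
    simp only [h1, zpow_zero, mul_one] at h2
    field_simp
    linear_combination h2
  obtain ⟨C, hC⟩ := hF.exists_const_of_mul_eq_conj hqr.symm hG hF' hG' (by
    filter_upwards [hquot] with t ht
    rw [hmul, hmul, ht, map_mul, Complex.conj_conj, Complex.conj_conj])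
  simp only [hmul] at hC
  have hC0 : C ≠ 0 := by
    obtain ⟨t, h1, h2, h3⟩ := (hC.and (h.plus_ne_zero.and h'.plus_ne_zero)).exists
    rw [← h1]
    exact mul_ne_zero h2 (inv_ne_zero h3)
  refine ⟨C, hC0, ?_, ?_⟩
  · filter_upwards [hC, h'.plus_ne_zero] with t h1 h2
    rw [← h1, inv_mul_cancel_right₀ h2]
  · filter_upwards [hC, hquot, h.minus_ne_zero] with t h1 h2 h3
    have h4 : C = (gm t)⁻¹ * hm t := h1.symm.trans h2
    rw [eq_inv_mul_iff_mul_eq₀ hC0, h4]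
    field_simp

/-- The projections of a branch of the logarithm are the logarithms of the factors up to a
constant. -/
lemma IsLogBranch.calProj_eq {p : ℝ} (hp : 1 < p) {hm hpl um up φ : ℝ → ℂ} {g : ℝ → ℂ}
    (h : IsCanonicalPFactorization p g hm hpl)
    (hum : IsLogOfFactor Side.lower (ENNReal.ofReal p) hm um)
    (hup : IsLogOfFactor Side.upper (ENNReal.ofReal p.conjExponent) hpl up)
    (hφ : ∀ᵐ x : ℝ, φ x = um x + up x) :
    MemCalL 2 φ ∧ ∃ c : ℂ, (∀ᵐ x : ℝ, calProj Side.upper φ x = up x + c) ∧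
      ∀ᵐ x : ℝ, calProj Side.lower φ x = um x - c := by
  have hqr := (Real.HolderConjugate.conjExponent hp)
  obtain ⟨ℓp, -, hpH, hpN⟩ := hup.exists_upperHardy hqr.symm h.plus_inv_mem h.plus_ne_zero
  have hmi := h.minus_inv_mem.conj
  simp only [map_inv₀] at hmi
  obtain ⟨ℓm, hmD, hmH, hmN⟩ := hum.conj.exists_upperHardy hqr hmi
    (h.minus_ne_zero.mono fun x hx => by simpa using hx)
  -- As `ℓm` is the reflected logarithm, `c` is the value at `-i` of the logarithm of `hm`.
  -- Subtracting it cancels the pole of `1 / (z + i)` in the lower half-plane; adding it to `up` is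
  -- harmless, since `c / (z + i)` belongs to `H²` above.
  set c : ℂ := (starRingEnd ℂ) (ℓm I)
  have hu : MemHardy Side.upper 2 fun t => (up t + c) / (t + I) := by
    refine (hpH.add_const_div c).memHardy (hpN.mono fun x hx a ha => ?_)
    have h1 : Tendsto (fun z : ℂ => z + I) (𝓝[Side.upper.cone a x] (x : ℂ)) (𝓝 ((x : ℂ) + I)) :=
      (Continuous.tendsto (by fun_prop) _).mono_left nhdsWithin_le_nhds
    exact ((hx a ha).add_const c).div h1 (add_I_ne_zero (by simp))
  have hv : MemHardy Side.lower 2 fun t => (um t - c) / (t + I) := by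
    have h1 := UpperHardy.dslope hmD hmN hmH
    have h2 := (h1.1.memHardy h1.2).conj
    simp only [map_div₀, map_sub, Complex.conj_conj, Complex.conj_ofReal, Complex.conj_I,
      sub_neg_eq_add] at h2
    exact h2
  have hsum : ∀ᵐ x : ℝ, φ x / Side.upper.lam x = (up x + c) / (x + I) + (um x - c) / (x + I) := by
    filter_upwards [hφ] with x hx
    rw [hx, Side.upper_lam]
    ring
  refine ⟨(hu.1.add hv.1).ae_eq (hsum.mono fun x hx => hx.symm), c, ?_, ?_⟩
  · have h1 := rieszProj_ae_eq (f := fun t : ℝ => φ t / Side.upper.lam t) hu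
      (hv.congr_ae (hsum.mono fun x hx => by beta_reduce; rw [hx]; ring))
    filter_upwards [h1] with x hx
    rw [calProj, hx, Side.upper_lam, mul_div_cancel₀ _ (add_I_ne_zero (by simp))]
  · have h1 := rieszProj_ae_eq (f := fun t : ℝ => φ t / Side.upper.lam t) hv
      (hu.congr_ae (hsum.mono fun x hx => by beta_reduce; rw [hx]; ring))
    filter_upwards [h1] with x hx
    rw [calProj, hx, Side.upper_lam, mul_div_cancel₀ _ (add_I_ne_zero (by simp))]

theorem corollary6p3 (p : ℝ) (hp : 1 < p) (g gm gp : ℝ → ℂ)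
    (hg : IsCanonicalPFactorization p g gm gp) :
    (∃ φ : ℝ → ℂ, IsLogBranch p g φ) ∧
    ∀ φ : ℝ → ℂ, IsLogBranch p g φ →
      (∀ᵐ x : ℝ, Complex.exp (φ x) = g x) ∧
      MemCalL 2 φ ∧
      ∃ C : ℂ, C ≠ 0 ∧
        (∀ᵐ x : ℝ, gp x = C * Complex.exp (calProj Side.upper φ x)) ∧
        (∀ᵐ x : ℝ, gm x = C⁻¹ * Complex.exp (calProj Side.lower φ x)) := by
  have hqr := (Real.HolderConjugate.conjExponent hp)
  refine ⟨?_, ?_⟩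
  · obtain ⟨um, hum⟩ := exists_isLogOfFactor hqr hg.minus_mem hg.minus_inv_mem hg.minus_ne_zero
    obtain ⟨up, hup⟩ := exists_isLogOfFactor hqr.symm hg.plus_mem hg.plus_inv_mem hg.plus_ne_zero
    exact ⟨fun x => um x + up x, gm, gp, um, up, hg, hum, hup, Eventually.of_forall fun _ => rfl⟩
  · rintro φ ⟨hm, hpl, um, up, hh, hum, hup, hφ⟩
    have hem := hum.exp_ae_eq
    have hep := hup.exp_ae_eq
    obtain ⟨hL, c, hcp, hcm⟩ := IsLogBranch.calProj_eq hp hh hum hup hφ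
    obtain ⟨C, hC, hCp, hCm⟩ := hg.exists_const hp hh
    -- The exponentials of the projections are `exp c * hpl` and `exp (-c) * hm`; the factor `exp
    -- (-c)` compensates for this in both formulas.
    refine ⟨?_, hL, C * Complex.exp (-c), mul_ne_zero hC (Complex.exp_ne_zero _), ?_, ?_⟩
    · filter_upwards [hφ, hem, hep, hh.eq_mul] with x h1 h2 h3 h4
      rw [h1, Complex.exp_add, h2, h3, h4, zpow_zero, mul_one]
    · filter_upwards [hCp, hcp, hep] with x h1 h2 h3
      rw [h1, h2, Complex.exp_add, h3, Complex.exp_neg]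
      have := Complex.exp_ne_zero c
      field_simp
    · filter_upwards [hCm, hcm, hem] with x h1 h2 h3
      rw [h1, h2, Complex.exp_sub, h3, Complex.exp_neg]
      have := Complex.exp_ne_zero c
      field_simp
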